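/- **Setting.** Let $(X_n)_{n\in\mathbb Z}$ be a real, centred, weakly stationary process in $L^2$ with autocovariance function $\sigma$, and let $0<d<1/2$. Consider the following assumptions. * (Long memory) $\sum_{h\in\mathbb Z}|\sigma(h)|=\infty$. * (Representations) $X_n=\sum_{j\ge0}b_j\varepsilon_{n-j}$ and $\varepsilon_n=\sum_{j\ge0}a_jX_{n-j}$ (convergence in $L^2$), where $(\varepsilon_n)_{n\in\mathbb Z}$ is a centred white noise of variance $\sigma_\varepsilon^2>0$, $(b_j)$ is square-summable, $(a_j)$ is absolutely summable and $a_0=1$. * (Decay) For every $\delta>0$ there are constants $C_1,C_2$ such that for all $j\ge1$ $$|a_j|\le C_1\,j^{-d-1+\delta},\qquad |b_j|\le C_2\,j^{d-1+\delta}.$$ For $k\ge0$ let $a_{1,k},\dots,a_{k,k}$ be a solution of the Yule–Walker equations $\sum_{i=1}^k a_{i,k}\,\sigma(i-j)=\sigma(j)$, $1\le j\le k$, and let $\widehat X_k(1)=\sum_{i=1}^k a_{i,k}X_{k+1-i}$ be the one-step predictor of $X_{k+1}$ in the fitted AR($k$) model. **Theorem.** (i) Under these assumptions the Yule–Walker equations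 have exactly one solution for every $k$. If the constants $C_1,C_2$ can be chosen independently of $\delta$, then, as $k\to\infty$, $$\mathbb E\big[(\widehat X_k(1)-X_{k+1})^2\big]-\sigma_\varepsilon^2=O(k^{-1}).$$ If they are allowed to depend on $\delta$, then for every $\delta>0$ $$\mathbb E\big[(\widehat X_k(1)-X_{k+1})^2\big]-\sigma_\varepsilon^2=O(k^{-1+\delta}).$$ (ii) The rate $k^{-1}$ is attained by fractionally integrated noise: there is a constant $C>0$, depending only on $d$, such that every F($d$) process $X_n=(1-B)^{-d}\varepsilon_n$ (with $B$ the backward shift, $(\varepsilon_n)$ a centred white noise of variance $\sigma_\varepsilon^2>0$, and the binomial series converging in $L^2$) satisfies all the assumptions above, with $(a_j)$, $(b_j)$ the coefficients of $(1-z)^{d}$ and $(1-z)^{-d}$ and with $C_1,C_2$ independent of $\delta$, and $$\mathbb E\big[(\widehat X_k(1)-X_{k+1})^2\big]-\sigma_\varepsilon^2\;\sim\;\frac{C\,\sigma_\varepsilon^2}{k}\qquad(k\to\infty).$$ -/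

import Mathlib

open MeasureTheory ProbabilityTheory Filter Topology Asymptotics

namespace LongMemory

noncomputable section

/-- Autocovariance function of a (weakly stationary) process indexed by the integers. -/
def autocov {Ω : Type*} [MeasurableSpace Ω] (μ : Measure Ω) (X : ℤ → Ω → ℝ) (h : ℤ) : ℝ :=
  cov[X h, X 0; μ]

/-- A centred weakly stationary process in `L²`. -/
structure IsCentredStationary {Ω : Type*} [MeasurableSpace Ω] (μ : Measure Ω)
    (X : ℤ → Ω → ℝ) : Prop where
  memLp : ∀ n, MemLp (X n) 2 μ
  mean_zero : ∀ n, ∫ ω, X n ω ∂μ = 0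
  cov_eq : ∀ n h, cov[X (n + h), X n; μ] = autocov μ X h

/-- White noise: centred uncorrelated square-integrable variables of common variance `v > 0`. -/
structure IsWhiteNoise {Ω : Type*} [MeasurableSpace Ω] (μ : Measure Ω)
    (ε : ℤ → Ω → ℝ) (v : ℝ) : Prop where
  var_pos : 0 < v
  memLp : ∀ n, MemLp (ε n) 2 μ
  mean_zero : ∀ n, ∫ ω, ε n ω ∂μ = 0
  var_eq : ∀ n, Var[ε n; μ] = v
  uncorrelated : ∀ m n, m ≠ n → cov[ε m, ε n; μ] = 0

/-- `Y n = ∑_{j ≥ 0} c j * Z (n - j)` for every `n`, the series converging in `L²`. -/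
def IsFiltered {Ω : Type*} [MeasurableSpace Ω] (μ : Measure Ω)
    (c : ℕ → ℝ) (Z Y : ℤ → Ω → ℝ) : Prop :=
  ∀ n : ℤ, Tendsto
    (fun N : ℕ => eLpNorm (fun ω => Y n ω - ∑ j ∈ Finset.range N, c j * Z (n - (j : ℤ)) ω) 2 μ)
    atTop (𝓝 0)

/-- For every `δ > 0`, `|c j| ≤ C j ^ (ρ + δ)` for `j ≥ 1`, where `C` may depend on `δ`. -/
def DecayUpTo (c : ℕ → ℝ) (ρ : ℝ) : Prop :=
  ∀ δ : ℝ, 0 < δ → ∃ C : ℝ, ∀ j : ℕ, 1 ≤ j → |c j| ≤ C * (j : ℝ) ^ (ρ + δ)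

/-- For every `δ > 0`, `|c j| ≤ C j ^ (ρ + δ)` for `j ≥ 1`, with one `C` for all `δ`. -/
def DecayUniform (c : ℕ → ℝ) (ρ : ℝ) : Prop :=
  ∃ C : ℝ, ∀ δ : ℝ, 0 < δ → ∀ j : ℕ, 1 ≤ j → |c j| ≤ C * (j : ℝ) ^ (ρ + δ)

/-- The long-memory model with memory parameter `d`, innovations `ε` of variance `v`,
autoregressive coefficients `a` and moving-average coefficients `b`. -/
structure IsLongMemoryModel {Ω : Type*} [MeasurableSpace Ω] (μ : Measure Ω)
    (X ε : ℤ → Ω → ℝ) (a b : ℕ → ℝ) (d v : ℝ) : Prop where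
  stationary : IsCentredStationary μ X
  noise : IsWhiteNoise μ ε v
  long_memory : ¬ Summable (fun h : ℤ => |autocov μ X h|)
  sq_summable : Summable (fun j => b j ^ 2)
  moving_average : IsFiltered μ b ε X
  abs_summable : Summable (fun j => |a j|)
  autoregressive : IsFiltered μ a X ε
  normalized : a 0 = 1
  decay_a : DecayUpTo a (-d - 1)
  decay_b : DecayUpTo b (d - 1)

/-- The coefficient of `z ^ j` in the binomial series of `(1 - z) ^ (-s)`. -/
def binomCoeff (s : ℝ) (j : ℕ) : ℝ := ∏ i ∈ Finset.range j, (s + i) / (i + 1)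

/-- Fractionally integrated noise F(d): `X n = (1 - B) ^ (-d) ε n`, with `B` the backward shift
and `ε` a white noise of variance `v`. -/
structure IsFractionalNoise {Ω : Type*} [MeasurableSpace Ω] (μ : Measure Ω)
    (X ε : ℤ → Ω → ℝ) (d v : ℝ) : Prop where
  memLp : ∀ n, MemLp (X n) 2 μ
  noise : IsWhiteNoise μ ε v
  moving_average : IsFiltered μ (binomCoeff d) ε X

/-- The Yule–Walker equations of order `k` for the autocovariance function `γ`;
`φ i` is the coefficient with (one-based) index `i + 1`. -/
def IsYuleWalker (γ : ℤ → ℝ) (k : ℕ) (φ : Fin k → ℝ) : Prop :=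
  ∀ j : Fin k, ∑ i : Fin k, φ i * γ ((i : ℤ) - (j : ℤ)) = γ ((j : ℤ) + 1)

/-- The next-step predictor of `X (n + 1)` in the AR(k) model with coefficients `φ`:
`φ 0 * X n + ⋯ + φ (k - 1) * X (n + 1 - k)`. -/
def arPredictor {Ω : Type*} (X : ℤ → Ω → ℝ) {k : ℕ} (φ : Fin k → ℝ) (n : ℤ) (ω : Ω) : ℝ :=
  ∑ i : Fin k, φ i * X (n - (i : ℤ)) ω

/-- The mean-squared error of the AR(k) prediction of `X (k + 1)` from `X 1, …, X k`. -/
def arError {Ω : Type*} [MeasurableSpace Ω] (μ : Measure Ω) (X : ℤ → Ω → ℝ) {k : ℕ}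
    (φ : Fin k → ℝ) : ℝ :=
  ∫ ω, (arPredictor X φ (k : ℤ) ω - X ((k : ℤ) + 1) ω) ^ 2 ∂μ

end

end LongMemory

/-!
In the Hilbert space `L²(μ)` the Yule–Walker equations are the normal equations of the best
linear prediction of `X (k + 1)` from `X 1, …, X k`.

The innovation `ε (k + 1)` is orthogonal to the past of `X` and has inner product `v` with
`X (k + 1)`. Hence finitely many values of `X` are linearly independent, which makes the
Yule–Walker equations uniquely solvable (`existsUnique_isYuleWalker`), and no predictor has an
error below `v` (`le_norm_sub_sq`). Comparing the best predictor with the truncated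
autoregressive expansion bounds the excess error by the squared norm of the tail
`∑_{j > k} a j X (k + 1 - j)` (`IsYuleWalker.norm_sub_sq_sub_le`). If `|a j| ≤ A j ^ (-p)` and
`|b j| ≤ B j ^ (-q)`, the autocovariances are `O(h ^ (1 - 2q))` and the tail has squared norm
`O(k ^ (3 - 2p - 2q))` (`exists_norm_tail_sq_le`); both bounds come from one estimate on sums of
powers, `sum_rpow_mul_rpow_le`. For `p = 1 + d` and `q = 1 - d` the exponent is `-1`, and a loss of
`η` in both decay rates changes it to `-1 + 4η`.

For fractional noise, a telescoping sum gives `(h + 1 - d) γ (h + 1) = (h + d) γ h`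
(`sum_binomCoeff_mul_shift`). This recursion holds on all of `ℤ`, and with it the Levinson algorithm
can be solved in closed form: the covariance of `X n` with the error of the prediction of `X 0` from
`X 1, …, X k` is a product (`levinsonCov`), which vanishes for `1 ≤ n ≤ k` and satisfies the
Levinson recursion with partial autocorrelation `d / (k + 1 - d)` (`levinsonCov_succ`). Its value at
`n = 0` is the prediction error `s k`, so `s (k + 1) = s k * (1 - d² / (k + 1 - d)²)`. Since `s k → v`
by the rate already established,
`s k - v` is asymptotic to `v * ∑_{j ≥ k} d² / (j + 1 - d)²`, that is to `d² v / k`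
(`isEquivalent_of_succ_eq`). The Hilbert space argument `IsNormFiltered.inverse` shows that
the filter `(1 - B) ^ d` recovers the innovations of fractional noise.
-/

namespace LongMemory

/-! ### Sums of powers -/

lemma sum_range_rpow_neg_le {r : ℝ} (hr0 : 0 ≤ r) (hr1 : r < 1) (n : ℕ) :
    ∑ h ∈ Finset.range n, ((h : ℝ) + 1) ^ (-r) ≤ (n : ℝ) ^ (1 - r) / (1 - r) := by
  induction n with
  | zero => simp [Real.zero_rpow (sub_pos.2 hr1).ne']
  | succ n ih =>
    rw [Finset.sum_range_succ]
    have hn : (0 : ℝ) < (n : ℝ) + 1 := by positivity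
    have h1 : (0 : ℝ) < 1 - r := sub_pos.2 hr1
    have hb : (1 + -(1 / ((n : ℝ) + 1))) ^ (1 - r) ≤ 1 + (1 - r) * -(1 / ((n : ℝ) + 1)) :=
      rpow_one_add_le_one_add_mul_self
        (by rw [neg_le_neg_iff, div_le_one hn]; linarith [n.cast_nonneg (α := ℝ)]) h1.le
        (by linarith)
    have hfac : (n : ℝ) = ((n : ℝ) + 1) * (1 + -(1 / ((n : ℝ) + 1))) := by field_simp; ring
    have hnn : (0 : ℝ) ≤ 1 + -(1 / ((n : ℝ) + 1)) := by
      have : 1 / ((n : ℝ) + 1) ≤ 1 := by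
        rw [div_le_one hn]; linarith [n.cast_nonneg (α := ℝ)]
      linarith
    have hpow : (n : ℝ) ^ (1 - r) ≤
        ((n : ℝ) + 1) ^ (1 - r) - (1 - r) * ((n : ℝ) + 1) ^ (-r) := by
      have hmul : ((n : ℝ) + 1) ^ (1 - r) = ((n : ℝ) + 1) ^ (-r) * ((n : ℝ) + 1) := by
        rw [← Real.rpow_add_one hn.ne']; ring_nf
      calc (n : ℝ) ^ (1 - r)
          = ((n : ℝ) + 1) ^ (1 - r) * (1 + -(1 / ((n : ℝ) + 1))) ^ (1 - r) := by
            rw [← Real.mul_rpow hn.le hnn, ← hfac]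
        _ ≤ ((n : ℝ) + 1) ^ (1 - r) * (1 + (1 - r) * -(1 / ((n : ℝ) + 1))) := by gcongr
        _ = ((n : ℝ) + 1) ^ (1 - r) - (1 - r) * ((n : ℝ) + 1) ^ (-r) := by
            rw [hmul]; field_simp; ring
    push_cast
    rw [le_div_iff₀ h1] at ih ⊢
    nlinarith [ih, hpow]

lemma sum_Ico_rpow_neg_le {s : ℝ} (hs : 1 < s) {m : ℕ} (hm : 1 ≤ m) (n : ℕ) :
    ∑ h ∈ Finset.Ico m n, ((h : ℝ) + 1) ^ (-s) ≤ (m : ℝ) ^ (1 - s) / (s - 1) := by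
  have hs1 : 0 < s - 1 := sub_pos.2 hs
  rcases lt_or_ge n m with hnm | hnm
  · rw [Finset.Ico_eq_empty (by omega), Finset.sum_empty]; positivity
  suffices h : ∑ h ∈ Finset.Ico m n, ((h : ℝ) + 1) ^ (-s) ≤
      ((m : ℝ) ^ (1 - s) - (n : ℝ) ^ (1 - s)) / (s - 1) from
    h.trans (by gcongr; linarith [Real.rpow_nonneg n.cast_nonneg (1 - s) (x := (n : ℝ))])
  induction n, hnm using Nat.le_induction with
  | base => simp
  | succ n hnm ih =>
    rw [Finset.sum_Ico_succ_top hnm]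
    have hn0 : (0 : ℝ) < n := by exact_mod_cast (by omega : 0 < n)
    have hn : (0 : ℝ) < (n : ℝ) + 1 := by positivity
    have hratio : (n : ℝ) / ((n : ℝ) + 1) ≤ Real.exp (-(1 / ((n : ℝ) + 1))) := by
      have := Real.add_one_le_exp (-(1 / ((n : ℝ) + 1)))
      refine le_trans (le_of_eq ?_) this
      field_simp; ring
    have hlow : 1 + (s - 1) * (1 / ((n : ℝ) + 1)) ≤ ((n : ℝ) / ((n : ℝ) + 1)) ^ (1 - s) := by
      calc 1 + (s - 1) * (1 / ((n : ℝ) + 1)) ≤ Real.exp ((s - 1) * (1 / ((n : ℝ) + 1))) := by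
            linarith [Real.add_one_le_exp ((s - 1) * (1 / ((n : ℝ) + 1)))]
        _ = Real.exp (-(1 / ((n : ℝ) + 1))) ^ (1 - s) := by
            rw [← Real.exp_mul]; ring_nf
        _ ≤ _ := Real.rpow_le_rpow_of_nonpos (by positivity) hratio (by linarith)
    have hpow : ((n : ℝ) + 1) ^ (1 - s) + (s - 1) * ((n : ℝ) + 1) ^ (-s) ≤ (n : ℝ) ^ (1 - s) := by
      have hmul : ((n : ℝ) + 1) ^ (1 - s) = ((n : ℝ) + 1) ^ (-s) * ((n : ℝ) + 1) := by
        rw [← Real.rpow_add_one hn.ne']; ring_nf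
      calc ((n : ℝ) + 1) ^ (1 - s) + (s - 1) * ((n : ℝ) + 1) ^ (-s)
          = ((n : ℝ) + 1) ^ (1 - s) * (1 + (s - 1) * (1 / ((n : ℝ) + 1))) := by
            rw [hmul]; field_simp
        _ ≤ ((n : ℝ) + 1) ^ (1 - s) * ((n : ℝ) / ((n : ℝ) + 1)) ^ (1 - s) := by gcongr
        _ = (n : ℝ) ^ (1 - s) := by
            rw [← Real.mul_rpow hn.le (by positivity), mul_div_cancel₀ _ hn.ne']
    push_cast
    rw [le_div_iff₀ hs1] at ih ⊢
    nlinarith [ih, hpow]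

/-- The bound has the order given by scaling: the terms `h < J` and `h ≥ J` are both
responsible for `J ^ (1 - p - r)`. -/
lemma sum_rpow_mul_rpow_le {p r : ℝ} (hp : 0 ≤ p) (hr0 : 0 ≤ r) (hr1 : r < 1) (hpr : 1 < p + r)
    {J : ℕ} (hJ : 1 ≤ J) (N : ℕ) :
    ∑ h ∈ Finset.range N, ((J : ℝ) + h) ^ (-p) * ((h : ℝ) + 1) ^ (-r) ≤
      (1 / (1 - r) + 1 / (p + r - 1)) * (J : ℝ) ^ (1 - p - r) := by
  have hJ0 : (0 : ℝ) < J := by exact_mod_cast hJ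
  have hJ1 : (1 : ℝ) ≤ J := by exact_mod_cast hJ
  calc ∑ h ∈ Finset.range N, ((J : ℝ) + h) ^ (-p) * ((h : ℝ) + 1) ^ (-r)
      ≤ ∑ h ∈ Finset.range (max J N), ((J : ℝ) + h) ^ (-p) * ((h : ℝ) + 1) ^ (-r) :=
        Finset.sum_le_sum_of_subset_of_nonneg
          (Finset.range_subset_range.2 (le_max_right _ _)) (fun _ _ _ => by positivity)
    _ = ∑ h ∈ Finset.range J, ((J : ℝ) + h) ^ (-p) * ((h : ℝ) + 1) ^ (-r) +
        ∑ h ∈ Finset.Ico J (max J N), ((J : ℝ) + h) ^ (-p) * ((h : ℝ) + 1) ^ (-r) :=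
        (Finset.sum_range_add_sum_Ico _ (le_max_left _ _)).symm
    _ ≤ ∑ h ∈ Finset.range J, (J : ℝ) ^ (-p) * ((h : ℝ) + 1) ^ (-r) +
        ∑ h ∈ Finset.Ico J (max J N), ((h : ℝ) + 1) ^ (-(p + r)) := by
        refine add_le_add (Finset.sum_le_sum fun h _ => ?_) (Finset.sum_le_sum fun h _ => ?_)
        · gcongr ?_ * _
          exact Real.rpow_le_rpow_of_nonpos hJ0 (by simp) (by linarith)
        · rw [neg_add, Real.rpow_add (by positivity)]
          gcongr ?_ * _
          exact Real.rpow_le_rpow_of_nonpos (by positivity) (by linarith) (by linarith)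
    _ ≤ (J : ℝ) ^ (-p) * ((J : ℝ) ^ (1 - r) / (1 - r)) +
        (J : ℝ) ^ (1 - (p + r)) / (p + r - 1) := by
        rw [← Finset.mul_sum]
        gcongr
        · exact sum_range_rpow_neg_le hr0 hr1 J
        · exact sum_Ico_rpow_neg_le hpr hJ _
    _ = _ := by
        rw [← mul_div_assoc, ← Real.rpow_add hJ0,
          show -p + (1 - r) = 1 - p - r by ring, show 1 - (p + r) = 1 - p - r by ring]
        ring

/-! ### Linear filters in a Hilbert space -/

section Hilbert

open scoped InnerProductSpace

variable {H : Type*} [NormedAddCommGroup H] [InnerProductSpace ℝ H]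

/-- `y n = ∑_{j ≥ 0} c j • z (n - j)` for every `n`, as a limit of partial sums in norm. -/
def IsNormFiltered (c : ℕ → ℝ) (z y : ℤ → H) : Prop :=
  ∀ n : ℤ, Tendsto (fun N : ℕ => ∑ j ∈ Finset.range N, c j • z (n - (j : ℤ))) atTop (𝓝 (y n))

/-- `e` is an orthogonal sequence of vectors of squared norm `v`. -/
def IsNoiseSeq (e : ℤ → H) (v : ℝ) : Prop :=
  ∀ m n : ℤ, ⟪e m, e n⟫_ℝ = if m = n then v else 0

variable {e x : ℤ → H} {a b : ℕ → ℝ} {v : ℝ}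

lemma IsNormFiltered.tendsto_inner {c : ℕ → ℝ} {z y : ℤ → H} (h : IsNormFiltered c z y)
    (w : H) (n : ℤ) :
    Tendsto (fun N : ℕ => ∑ j ∈ Finset.range N, c j * ⟪w, z (n - (j : ℤ))⟫_ℝ) atTop
      (𝓝 ⟪w, y n⟫_ℝ) := by
  have h1 := (continuous_const.inner continuous_id).tendsto (y n) (f := fun y : H => ⟪w, y⟫_ℝ)
  refine (h1.comp (h n)).congr fun N => ?_
  simp [inner_sum, inner_smul_right]

lemma IsNormFiltered.inner_noise_of_le (hb : IsNormFiltered b e x) (he : IsNoiseSeq e v)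
    (n : ℤ) (i : ℕ) : ⟪e (n - i), x n⟫_ℝ = b i * v := by
  refine tendsto_nhds_unique (hb.tendsto_inner (e (n - i)) n) ?_
  refine tendsto_const_nhds.congr' ?_
  filter_upwards [eventually_gt_atTop i] with N hN
  rw [Finset.sum_eq_single_of_mem i (Finset.mem_range.2 hN)]
  · rw [he, if_pos rfl]
  · intro j _ hj
    rw [he, if_neg (by omega), mul_zero]

lemma IsNormFiltered.inner_noise_of_lt (hb : IsNormFiltered b e x) (he : IsNoiseSeq e v)
    {m n : ℤ} (hmn : n < m) : ⟪e m, x n⟫_ℝ = 0 := by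
  refine tendsto_nhds_unique (hb.tendsto_inner (e m) n) (tendsto_const_nhds.congr fun N => ?_)
  refine (Finset.sum_eq_zero fun j _ => ?_).symm
  rw [he, if_neg (by omega), mul_zero]

lemma IsNormFiltered.tendsto_inner_shift (hb : IsNormFiltered b e x) (he : IsNoiseSeq e v)
    (n : ℤ) (h : ℕ) :
    Tendsto (fun N : ℕ => v * ∑ j ∈ Finset.range N, b j * b (j + h)) atTop
      (𝓝 ⟪x (n + h), x n⟫_ℝ) := by
  refine (hb.tendsto_inner (x (n + h)) n).congr fun N => ?_
  rw [Finset.mul_sum]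
  refine Finset.sum_congr rfl fun j _ => ?_
  have h1 := hb.inner_noise_of_le he (n + h) (j + h)
  rw [real_inner_comm, show n - (j : ℤ) = n + h - ((j + h : ℕ) : ℤ) by push_cast; ring, h1]
  ring

lemma inner_noise_self (ha : IsNormFiltered a x e) (hb : IsNormFiltered b e x)
    (he : IsNoiseSeq e v) (ha0 : a 0 = 1) (n : ℤ) : ⟪e n, x n⟫_ℝ = v := by
  have h1 := ha.tendsto_inner (e n) n
  rw [he, if_pos rfl] at h1
  refine tendsto_nhds_unique (tendsto_const_nhds.congr' ?_) h1
  filter_upwards [eventually_gt_atTop 0] with N hN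
  rw [Finset.sum_eq_single_of_mem 0 (Finset.mem_range.2 hN)]
  · simp [ha0]
  · intro j _ hj
    rw [hb.inner_noise_of_lt he (by omega), mul_zero]

lemma inner_noise_sum_past (hb : IsNormFiltered b e x) (he : IsNoiseSeq e v) {k : ℕ}
    (φ : Fin k → ℝ) (n : ℤ) : ⟪e (n + 1), ∑ i : Fin k, φ i • x (n - (i : ℤ))⟫_ℝ = 0 := by
  rw [inner_sum]
  refine Finset.sum_eq_zero fun i _ => ?_
  rw [inner_smul_right, hb.inner_noise_of_lt he (by omega), mul_zero]

/-- The innovation `e (n + 1)` is orthogonal to every predictor of `x (n + 1)` and has inner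
product `v` with `x (n + 1)`, so that no prediction error is below `v`. -/
lemma le_norm_sub_sq (ha : IsNormFiltered a x e) (hb : IsNormFiltered b e x)
    (he : IsNoiseSeq e v) (hv : 0 < v) (ha0 : a 0 = 1) {k : ℕ} (φ : Fin k → ℝ) (n : ℤ) :
    v ≤ ‖(∑ i : Fin k, φ i • x (n - (i : ℤ))) - x (n + 1)‖ ^ 2 := by
  set w := (∑ i : Fin k, φ i • x (n - (i : ℤ))) - x (n + 1) with hw
  have h1 : ⟪e (n + 1), w⟫_ℝ = -v := by
    rw [hw, inner_sub_right, inner_noise_sum_past hb he, inner_noise_self ha hb he ha0, zero_sub]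
  have h2 := real_inner_mul_inner_self_le (e (n + 1)) w
  rw [h1, he, if_pos rfl, real_inner_self_eq_norm_sq] at h2
  nlinarith [h2]

/-- Finitely many consecutive values of the process are linearly independent. -/
lemma eq_zero_of_sum_smul_eq_zero (ha : IsNormFiltered a x e) (hb : IsNormFiltered b e x)
    (he : IsNoiseSeq e v) (hv : 0 < v) (ha0 : a 0 = 1) {k : ℕ} (φ : Fin k → ℝ) (n : ℤ)
    (h0 : ∑ i : Fin k, φ i • x (n - (i : ℤ)) = 0) : φ = 0 := by
  funext i
  induction i using WellFoundedLT.induction with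
  | ind i ih =>
    have h1 : ⟪e (n - (i : ℤ)), ∑ i : Fin k, φ i • x (n - (i : ℤ))⟫_ℝ = φ i * v := by
      rw [inner_sum, Finset.sum_eq_single_of_mem i (Finset.mem_univ i),
        inner_smul_right, inner_noise_self ha hb he ha0]
      intro j _ hj
      rcases lt_or_gt_of_ne hj with hji | hji
      · simp [ih j hji]
      · rw [inner_smul_right, hb.inner_noise_of_lt he, mul_zero]
        have : (i : ℕ) < (j : ℕ) := hji
        omega
    rw [h0, inner_zero_right] at h1
    exact (mul_eq_zero.1 h1.symm).resolve_right hv.ne'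

variable {γ : ℤ → ℝ}

lemma isYuleWalker_iff_inner (hγ : ∀ n h : ℤ, ⟪x (n + h), x n⟫_ℝ = γ h) {k : ℕ}
    (φ : Fin k → ℝ) (n : ℤ) :
    IsYuleWalker γ k φ ↔
      ∀ j : Fin k, ⟪x (n - (j : ℤ)), (∑ i : Fin k, φ i • x (n - (i : ℤ))) - x (n + 1)⟫_ℝ = 0 := by
  refine forall_congr' fun j => ?_
  have h1 : ⟪x (n - (j : ℤ)), x (n + 1)⟫_ℝ = γ ((j : ℤ) + 1) := by
    rw [real_inner_comm, ← hγ (n - (j : ℤ)) ((j : ℤ) + 1)]; congr 2; ring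
  have h2 (i : Fin k) : ⟪x (n - (j : ℤ)), x (n - (i : ℤ))⟫_ℝ = γ ((i : ℤ) - (j : ℤ)) := by
    rw [← hγ (n - (i : ℤ)) ((i : ℤ) - (j : ℤ))]; congr 2; ring
  simp only [inner_sub_right, inner_sum, inner_smul_right, h1, h2, sub_eq_zero]

lemma existsUnique_isYuleWalker (ha : IsNormFiltered a x e) (hb : IsNormFiltered b e x)
    (he : IsNoiseSeq e v) (hv : 0 < v) (ha0 : a 0 = 1)
    (hγ : ∀ n h : ℤ, ⟪x (n + h), x n⟫_ℝ = γ h) (k : ℕ) :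
    ∃! φ : Fin k → ℝ, IsYuleWalker γ k φ := by
  let T : (Fin k → ℝ) →ₗ[ℝ] (Fin k → ℝ) :=
    LinearMap.pi fun j : Fin k => ∑ i : Fin k, γ ((i : ℤ) - (j : ℤ)) • LinearMap.proj i
  have hT (φ : Fin k → ℝ) (j : Fin k) :
      T φ j = ⟪x (-(j : ℤ)), ∑ i : Fin k, φ i • x (-(i : ℤ))⟫_ℝ := by
    simp only [T, LinearMap.pi_apply, LinearMap.sum_apply, LinearMap.smul_apply,
      LinearMap.proj_apply, smul_eq_mul, inner_sum, inner_smul_right]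
    refine Finset.sum_congr rfl fun i _ => ?_
    rw [mul_comm, ← hγ (-(i : ℤ)) ((i : ℤ) - (j : ℤ))]
    congr 3; ring
  have hinj : Function.Injective T := by
    rw [← LinearMap.ker_eq_bot, LinearMap.ker_eq_bot']
    intro φ hφ
    refine eq_zero_of_sum_smul_eq_zero ha hb he hv ha0 φ 0 ?_
    simp only [zero_sub]
    rw [← inner_self_eq_zero (𝕜 := ℝ), sum_inner]
    refine Finset.sum_eq_zero fun j _ => ?_
    rw [real_inner_smul_left, ← hT, hφ, Pi.zero_apply, mul_zero]
  have hiff (φ : Fin k → ℝ) : IsYuleWalker γ k φ ↔ T φ = fun j : Fin k => γ ((j : ℤ) + 1) := by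
    rw [funext_iff]
    refine forall_congr' fun j => ?_
    simp [T, mul_comm]
  simp only [hiff]
  exact Function.Bijective.existsUnique
    ⟨hinj, LinearMap.injective_iff_surjective.1 hinj⟩ _

/-- A solution of the Yule–Walker equations is a best linear predictor. -/
lemma IsYuleWalker.norm_sub_sq_le (hγ : ∀ n h : ℤ, ⟪x (n + h), x n⟫_ℝ = γ h) {k : ℕ}
    {φ : Fin k → ℝ} (hφ : IsYuleWalker γ k φ) (ψ : Fin k → ℝ) (n : ℤ) :
    ‖(∑ i : Fin k, φ i • x (n - (i : ℤ))) - x (n + 1)‖ ^ 2 ≤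
      ‖(∑ i : Fin k, ψ i • x (n - (i : ℤ))) - x (n + 1)‖ ^ 2 := by
  set r := (∑ i : Fin k, φ i • x (n - (i : ℤ))) - x (n + 1) with hr
  set s := ∑ i : Fin k, (ψ i - φ i) • x (n - (i : ℤ)) with hs
  have h1 : (∑ i : Fin k, ψ i • x (n - (i : ℤ))) - x (n + 1) = s + r := by
    simp only [hr, hs, sub_smul, Finset.sum_sub_distrib]; abel
  have h2 : ⟪s, r⟫_ℝ = 0 := by
    rw [hs, sum_inner]
    refine Finset.sum_eq_zero fun j _ => ?_
    rw [real_inner_smul_left, (isYuleWalker_iff_inner hγ φ n).1 hφ j, mul_zero]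
  rw [h1, norm_add_sq_real, h2]
  nlinarith [sq_nonneg ‖s‖]

lemma IsYuleWalker.norm_sub_sq_eq (hγ : ∀ n h : ℤ, ⟪x (n + h), x n⟫_ℝ = γ h) {k : ℕ}
    {φ : Fin k → ℝ} (hφ : IsYuleWalker γ k φ) (n : ℤ) :
    ‖(∑ i : Fin k, φ i • x (n - (i : ℤ))) - x (n + 1)‖ ^ 2 =
      γ 0 - ∑ i : Fin k, φ i * γ ((i : ℤ) + 1) := by
  have h1 (i : Fin k) : ⟪x (n + 1), x (n - (i : ℤ))⟫_ℝ = γ ((i : ℤ) + 1) := by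
    rw [← hγ (n - (i : ℤ)) ((i : ℤ) + 1)]; congr 2; ring
  have h2 : ⟪x (n + 1), x (n + 1)⟫_ℝ = γ 0 := by simpa using hγ (n + 1) 0
  rw [← real_inner_self_eq_norm_sq, inner_sub_left, sum_inner]
  rw [Finset.sum_eq_zero, zero_sub, inner_sub_right, h2, inner_sum]
  · simp [inner_smul_right, h1]
  · intro j _
    rw [real_inner_smul_left, (isYuleWalker_iff_inner hγ φ n).1 hφ j, mul_zero]

/-- The error of the best predictor from `k` values exceeds `v` at most by the squared norm of
the tail of the autoregressive expansion: compare with the truncated expansion. -/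
lemma IsYuleWalker.norm_sub_sq_sub_le (ha : IsNormFiltered a x e) (hb : IsNormFiltered b e x)
    (he : IsNoiseSeq e v) (ha0 : a 0 = 1)
    (hγ : ∀ n h : ℤ, ⟪x (n + h), x n⟫_ℝ = γ h) {k : ℕ}
    {φ : Fin k → ℝ} (hφ : IsYuleWalker γ k φ) (n : ℤ) {M : ℝ}
    (hM : ∀ N, ‖∑ j ∈ Finset.Ico (k + 1) N, a j • x (n + 1 - (j : ℤ))‖ ^ 2 ≤ M) :
    ‖(∑ i : Fin k, φ i • x (n - (i : ℤ))) - x (n + 1)‖ ^ 2 - v ≤ M := by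
  set p := ∑ i : Fin k, (-a (i + 1)) • x (n - (i : ℤ)) with hp
  set t := e (n + 1) + (p - x (n + 1)) with ht
  have hsum : p - x (n + 1) = -∑ j ∈ Finset.range (k + 1), a j • x (n + 1 - (j : ℤ)) := by
    rw [Finset.sum_range_succ', ha0, hp, Fin.sum_univ_eq_sum_range
      (fun i : ℕ => (-a (i + 1)) • x (n - (i : ℤ))) k]
    simp only [neg_smul, Finset.sum_neg_distrib, one_smul, Nat.cast_zero, sub_zero, neg_add]
    rw [sub_eq_add_neg]
    congr 2
    refine Finset.sum_congr rfl fun i _ => ?_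
    congr 2; push_cast; ring
  have htM : ‖t‖ ^ 2 ≤ M := by
    have h1 : Tendsto (fun N : ℕ => ∑ j ∈ Finset.Ico (k + 1) N, a j • x (n + 1 - (j : ℤ))) atTop
        (𝓝 t) := by
      refine ((ha (n + 1)).add_const (p - x (n + 1))).congr' ?_
      filter_upwards [eventually_ge_atTop (k + 1)] with N hN
      rw [hsum, ← Finset.sum_range_add_sum_Ico _ hN]; abel
    exact le_of_tendsto' (h1.norm.pow 2) hM
  have het : ⟪e (n + 1), t⟫_ℝ = 0 := by
    rw [ht, inner_add_right, he, if_pos rfl, inner_sub_right, hp, inner_noise_sum_past hb he,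
      inner_noise_self ha hb he ha0]
    ring
  have h2 : ‖p - x (n + 1)‖ ^ 2 = ‖t‖ ^ 2 + v := by
    have : p - x (n + 1) = t - e (n + 1) := by rw [ht]; abel
    rw [this, norm_sub_sq_real, real_inner_comm, het, ← real_inner_self_eq_norm_sq (e (n + 1)),
      he, if_pos rfl]
    ring
  have h3 := hφ.norm_sub_sq_le hγ (fun i => -a (i + 1)) n
  linarith

end Hilbert

/-! ### The tail of the autoregressive expansion -/

section Tail

open scoped InnerProductSpace

variable {H : Type*} [NormedAddCommGroup H] [InnerProductSpace ℝ H]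

lemma exists_abs_inner_shift_le {e x : ℤ → H} {b : ℕ → ℝ} {v : ℝ} (hb : IsNormFiltered b e x)
    (he : IsNoiseSeq e v) (hv : 0 < v) {q : ℝ} (hq1 : 1 / 2 < q) (hq2 : q < 1)
    {B : ℝ} (hB : ∀ j : ℕ, |b j| ≤ B * ((j : ℝ) + 1) ^ (-q)) :
    ∃ S : ℝ, 0 ≤ S ∧ ∀ (n : ℤ) (h : ℕ),
      |⟪x (n + h), x n⟫_ℝ| ≤ S * ((h : ℝ) + 1) ^ (-(2 * q - 1)) := by
  have hB0 : 0 ≤ B := by simpa using (abs_nonneg _).trans (hB 0)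
  set K := 1 / (1 - q) + 1 / (q + q - 1) with hK
  have hK0 : 0 ≤ K :=
    add_nonneg (one_div_nonneg.2 (by linarith)) (one_div_nonneg.2 (by linarith))
  refine ⟨v * (B ^ 2 * K), by positivity, fun n h => ?_⟩
  refine le_of_tendsto' (hb.tendsto_inner_shift he n h).abs fun N => ?_
  rw [abs_mul, abs_of_pos hv, mul_assoc]
  gcongr
  calc |∑ j ∈ Finset.range N, b j * b (j + h)|
      ≤ ∑ j ∈ Finset.range N,
          B ^ 2 * ((((h + 1 : ℕ) : ℝ) + j) ^ (-q) * ((j : ℝ) + 1) ^ (-q)) := by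
        refine (Finset.abs_sum_le_sum_abs _ _).trans (Finset.sum_le_sum fun j _ => ?_)
        rw [abs_mul]
        have h1 := hB (j + h)
        rw [show ((j + h : ℕ) : ℝ) + 1 = ((h + 1 : ℕ) : ℝ) + j by push_cast; ring] at h1
        calc |b j| * |b (j + h)| ≤ (B * ((j : ℝ) + 1) ^ (-q)) *
              (B * (((h + 1 : ℕ) : ℝ) + j) ^ (-q)) :=
              mul_le_mul (hB j) h1 (abs_nonneg _) (by positivity)
          _ = _ := by ring
    _ ≤ B ^ 2 * (K * ((h + 1 : ℕ) : ℝ) ^ (1 - q - q)) := by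
        rw [← Finset.mul_sum]
        gcongr
        exact sum_rpow_mul_rpow_le (by linarith) (by linarith) hq2 (by linarith) (by omega) N
    _ = B ^ 2 * K * ((h : ℝ) + 1) ^ (-(2 * q - 1)) := by
        rw [show 1 - q - q = -(2 * q - 1) by ring]; push_cast; ring

/-- A double sum of a nonnegative symmetric function is at most twice the sum over `j ≤ l`. -/
lemma sum_sum_le_two_mul_sum_Ico {f : ℕ → ℕ → ℝ} (hf : ∀ j l, 0 ≤ f j l)
    (hsymm : ∀ j l, f j l = f l j) (m N : ℕ) :
    ∑ j ∈ Finset.Ico m N, ∑ l ∈ Finset.Ico m N, f j l ≤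
      2 * ∑ j ∈ Finset.Ico m N, ∑ l ∈ Finset.Ico j N, f j l := by
  have h1 : ∑ j ∈ Finset.Ico m N, ∑ l ∈ Finset.Ico j N, f j l =
      ∑ j ∈ Finset.Ico m N, ∑ l ∈ Finset.Ico m N, if j ≤ l then f j l else 0 := by
    refine Finset.sum_congr rfl fun j hj => ?_
    rw [← Finset.sum_filter]
    refine Finset.sum_congr ?_ fun _ _ => rfl
    ext l
    simp only [Finset.mem_Ico, Finset.mem_filter] at hj ⊢
    omega
  have h2 : ∑ j ∈ Finset.Ico m N, ∑ l ∈ Finset.Ico j N, f j l =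
      ∑ j ∈ Finset.Ico m N, ∑ l ∈ Finset.Ico m N, if l ≤ j then f j l else 0 := by
    rw [h1, Finset.sum_comm]
    simp only [hsymm]
  rw [two_mul]
  nth_rewrite 1 [h1]
  rw [h2, ← Finset.sum_add_distrib]
  refine Finset.sum_le_sum fun j _ => ?_
  rw [← Finset.sum_add_distrib]
  refine Finset.sum_le_sum fun l _ => ?_
  have := hf j l
  rcases le_total j l with h | h <;> simp only [h, if_true] <;> split_ifs <;> linarith

/-- If the coefficients decay like `j ^ (-p)` and the correlations like `h ^ (-r)`, the squared
norm of the tail beyond `k` is `O(k ^ (2 - 2p - r))`. -/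
lemma exists_norm_tail_sq_le {x : ℤ → H} {a : ℕ → ℝ} {p r A S : ℝ} (hp : 1 < p) (hr0 : 0 < r)
    (hr1 : r < 1) (hS0 : 0 ≤ S)
    (hA : ∀ j : ℕ, 1 ≤ j → |a j| ≤ A * (j : ℝ) ^ (-p))
    (hS : ∀ (n : ℤ) (h : ℕ), |⟪x (n + h), x n⟫_ℝ| ≤ S * ((h : ℝ) + 1) ^ (-r)) :
    ∃ C : ℝ, ∀ k : ℕ, 1 ≤ k → ∀ (n : ℤ) (N : ℕ),
      ‖∑ j ∈ Finset.Ico (k + 1) N, a j • x (n - (j : ℤ))‖ ^ 2 ≤ C * (k : ℝ) ^ (2 - 2 * p - r) := by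
  have hA0 : 0 ≤ A := by simpa using (abs_nonneg _).trans (hA 1 le_rfl)
  set K := 1 / (1 - r) + 1 / (p + r - 1) with hK
  have hK0 : 0 ≤ K :=
    add_nonneg (one_div_nonneg.2 (by linarith)) (one_div_nonneg.2 (by linarith))
  have hs : 0 < 2 * p + r - 1 - 1 := by linarith
  refine ⟨2 * (A ^ 2 * S * K / (2 * p + r - 1 - 1)), fun k hk n N => ?_⟩
  set f : ℕ → ℕ → ℝ := fun j l => |a j| * |a l| * |⟪x (n - (j : ℤ)), x (n - (l : ℤ))⟫_ℝ| with hf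
  have hrow (j : ℕ) (hj : 1 ≤ j) :
      ∑ l ∈ Finset.Ico j N, f j l ≤ A ^ 2 * S * K * (j : ℝ) ^ (-(2 * p + r - 1)) := by
    have hj0 : (0 : ℝ) < j := by exact_mod_cast hj
    rw [Finset.sum_Ico_eq_sum_range]
    calc ∑ h ∈ Finset.range (N - j), f j (j + h)
        ≤ ∑ h ∈ Finset.range (N - j), A ^ 2 * S * (j : ℝ) ^ (-p) *
            (((j : ℝ) + h) ^ (-p) * ((h : ℝ) + 1) ^ (-r)) := by
          refine Finset.sum_le_sum fun h _ => ?_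
          have h1 := hA j hj
          have h2 := hA (j + h) (by omega)
          have h3 := hS (n - ((j + h : ℕ) : ℤ)) h
          rw [show n - ((j + h : ℕ) : ℤ) + h = n - j by push_cast; ring] at h3
          push_cast at h2
          calc f j (j + h) ≤ (A * (j : ℝ) ^ (-p)) * (A * ((j : ℝ) + h) ^ (-p)) *
                (S * ((h : ℝ) + 1) ^ (-r)) := by
                simp only [hf]; gcongr
            _ = _ := by ring
      _ ≤ A ^ 2 * S * (j : ℝ) ^ (-p) * (K * (j : ℝ) ^ (1 - p - r)) := by
          rw [← Finset.mul_sum]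
          gcongr
          exact sum_rpow_mul_rpow_le (by linarith) hr0.le hr1 (by linarith) hj _
      _ = A ^ 2 * S * K * ((j : ℝ) ^ (-p) * (j : ℝ) ^ (1 - p - r)) := by ring
      _ = _ := by rw [← Real.rpow_add hj0]; ring_nf
  have htail : ∑ j ∈ Finset.Ico (k + 1) N, (j : ℝ) ^ (-(2 * p + r - 1)) ≤
      (k : ℝ) ^ (2 - 2 * p - r) / (2 * p + r - 1 - 1) := by
    have h1 := sum_Ico_rpow_neg_le (s := 2 * p + r - 1) (by linarith) hk N
    rw [show 1 - (2 * p + r - 1) = 2 - 2 * p - r by ring] at h1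
    refine le_trans ?_ h1
    have h2 := Finset.sum_Ico_add' (fun j : ℕ => (j : ℝ) ^ (-(2 * p + r - 1))) k N 1
    push_cast at h2
    rw [h2]
    exact Finset.sum_le_sum_of_subset_of_nonneg (Finset.Ico_subset_Ico_right (by omega))
      (fun _ _ _ => by positivity)
  calc ‖∑ j ∈ Finset.Ico (k + 1) N, a j • x (n - (j : ℤ))‖ ^ 2
      = ∑ j ∈ Finset.Ico (k + 1) N, ∑ l ∈ Finset.Ico (k + 1) N,
          a j * a l * ⟪x (n - (j : ℤ)), x (n - (l : ℤ))⟫_ℝ := by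
        rw [← real_inner_self_eq_norm_sq, sum_inner]
        refine Finset.sum_congr rfl fun j _ => ?_
        rw [inner_sum]
        refine Finset.sum_congr rfl fun l _ => ?_
        rw [real_inner_smul_left, real_inner_smul_right]; ring
    _ ≤ ∑ j ∈ Finset.Ico (k + 1) N, ∑ l ∈ Finset.Ico (k + 1) N, f j l := by
        gcongr with j _ l _
        exact (le_abs_self _).trans (by rw [abs_mul, abs_mul])
    _ ≤ 2 * ∑ j ∈ Finset.Ico (k + 1) N, ∑ l ∈ Finset.Ico j N, f j l := by
        refine sum_sum_le_two_mul_sum_Ico (fun _ _ => by positivity) (fun j l => ?_) _ _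
        simp only [hf]
        rw [real_inner_comm, mul_comm |a j|]
    _ ≤ 2 * ∑ j ∈ Finset.Ico (k + 1) N, A ^ 2 * S * K * (j : ℝ) ^ (-(2 * p + r - 1)) := by
        gcongr with j hj
        exact hrow j (by rw [Finset.mem_Ico] at hj; omega)
    _ ≤ 2 * (A ^ 2 * S * K * ((k : ℝ) ^ (2 - 2 * p - r) / (2 * p + r - 1 - 1))) := by
        rw [← Finset.mul_sum]
        gcongr
    _ = _ := by ring

/-- The rate of the best predictor from `k` values: with `p = d + 1` and `q = 1 - d` it
is `k⁻¹`. -/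
lemma exists_norm_sub_sq_sub_le {e x : ℤ → H} {a b : ℕ → ℝ} {v : ℝ}
    (ha : IsNormFiltered a x e) (hb : IsNormFiltered b e x)
    (he : IsNoiseSeq e v) (hv : 0 < v) (ha0 : a 0 = 1) {γ : ℤ → ℝ}
    (hγ : ∀ n h : ℤ, ⟪x (n + h), x n⟫_ℝ = γ h)
    {p q A B : ℝ} (hp : 1 < p) (hq1 : 1 / 2 < q) (hq2 : q < 1)
    (hA : ∀ j : ℕ, 1 ≤ j → |a j| ≤ A * (j : ℝ) ^ (-p))
    (hB : ∀ j : ℕ, 1 ≤ j → |b j| ≤ B * (j : ℝ) ^ (-q)) :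
    ∃ C : ℝ, ∀ k : ℕ, 1 ≤ k → ∀ φ : Fin k → ℝ, IsYuleWalker γ k φ → ∀ n : ℤ,
      ‖(∑ i : Fin k, φ i • x (n - (i : ℤ))) - x (n + 1)‖ ^ 2 - v ≤
        C * (k : ℝ) ^ (3 - 2 * p - 2 * q) := by
  have hB0 : 0 ≤ B := by simpa using (abs_nonneg _).trans (hB 1 le_rfl)
  have hB' (j : ℕ) : |b j| ≤ max |b 0| (B * 2 ^ q) * ((j : ℝ) + 1) ^ (-q) := by
    rcases Nat.eq_zero_or_pos j with rfl | hj
    · simp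
    · have hj0 : (1 : ℝ) ≤ j := by exact_mod_cast hj
      have hj' : (0 : ℝ) < j := by linarith
      refine (hB j hj).trans ?_
      calc B * (j : ℝ) ^ (-q) = B * 2 ^ q * (2 * (j : ℝ)) ^ (-q) := by
            rw [Real.mul_rpow (by norm_num) hj'.le, mul_assoc, ← mul_assoc (2 ^ q),
              ← Real.rpow_add (by norm_num), add_neg_cancel, Real.rpow_zero, one_mul]
        _ ≤ B * 2 ^ q * ((j : ℝ) + 1) ^ (-q) := by
            gcongr ?_ * ?_
            exact Real.rpow_le_rpow_of_nonpos (by positivity) (by linarith) (by linarith)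
        _ ≤ _ := by
            gcongr
            exact le_max_right _ _
  obtain ⟨S, hS0, hS⟩ := exists_abs_inner_shift_le hb he hv hq1 hq2 hB'
  obtain ⟨C, hC⟩ := exists_norm_tail_sq_le hp (by linarith) (by linarith) hS0 hA hS
  refine ⟨C, fun k hk φ hφ n => ?_⟩
  rw [show 3 - 2 * p - 2 * q = 2 - 2 * p - (2 * q - 1) by ring]
  exact hφ.norm_sub_sq_sub_le ha hb he ha0 hγ n (hC k hk (n + 1))

end Tail

/-! ### Processes as sequences in `L²` -/

section L2

open scoped InnerProductSpace

variable {Ω : Type*} [MeasurableSpace Ω] {μ : Measure Ω}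

/-- A process with square-integrable values as a sequence of elements of `L²(μ)`. -/
noncomputable def toL2 {X : ℤ → Ω → ℝ} (hX : ∀ n, MemLp (X n) 2 μ) (n : ℤ) : Lp ℝ 2 μ :=
  (hX n).toLp (X n)

lemma inner_toLp {f g : Ω → ℝ} (hf : MemLp f 2 μ) (hg : MemLp g 2 μ) :
    ⟪hf.toLp f, hg.toLp g⟫_ℝ = ∫ ω, f ω * g ω ∂μ := by
  rw [L2.inner_def]
  refine integral_congr_ae ?_
  filter_upwards [hf.coeFn_toLp, hg.coeFn_toLp] with ω h1 h2
  rw [h1, h2, real_inner_eq_re_inner]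
  simp [mul_comm]

lemma inner_toLp_eq_cov [IsProbabilityMeasure μ] {f g : Ω → ℝ} (hf : MemLp f 2 μ)
    (hg : MemLp g 2 μ) (hg0 : ∫ ω, g ω ∂μ = 0) : ⟪hf.toLp f, hg.toLp g⟫_ℝ = cov[f, g; μ] := by
  rw [inner_toLp, covariance_eq_sub hf hg, hg0, mul_zero, sub_zero]
  rfl

lemma toLp_sum_smul {ι : Type*} (s : Finset ι) (c : ι → ℝ) {f : ι → Ω → ℝ}
    (hf : ∀ i, MemLp (f i) 2 μ) (h : MemLp (fun ω => ∑ i ∈ s, c i * f i ω) 2 μ) :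
    h.toLp _ = ∑ i ∈ s, c i • (hf i).toLp (f i) := by
  have h1 (i : ι) : MemLp (fun ω => c i * f i ω) 2 μ := (hf i).const_mul (c i)
  have h2 : h.toLp _ = ∑ i ∈ s, (h1 i).toLp _ := by
    classical
    induction s using Finset.induction_on with
    | empty => simp only [Finset.sum_empty]; exact MemLp.toLp_zero _
    | insert i s hi ih =>
      have h3 : MemLp (fun ω => ∑ i ∈ s, c i * f i ω) 2 μ := memLp_finsetSum s fun i _ => h1 i
      rw [Finset.sum_insert hi, ← ih h3, ← MemLp.toLp_add]
      congr 1
      funext ω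
      simp [Finset.sum_insert hi]
  rw [h2]
  rfl

lemma isFiltered_iff_isNormFiltered {c : ℕ → ℝ} {Z Y : ℤ → Ω → ℝ}
    (hZ : ∀ n, MemLp (Z n) 2 μ) (hY : ∀ n, MemLp (Y n) 2 μ) :
    IsFiltered μ c Z Y ↔ IsNormFiltered c (toL2 hZ) (toL2 hY) := by
  refine forall_congr' fun n => ?_
  have h1 (N : ℕ) : MemLp (fun ω => ∑ j ∈ Finset.range N, c j * Z (n - (j : ℤ)) ω) 2 μ :=
    memLp_finsetSum _ fun j _ => (hZ _).const_mul _
  have h2 := Lp.tendsto_Lp_iff_tendsto_eLpNorm'' (fi := atTop) _ h1 (Y n) (hY n)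
  simp only [toL2]
  rw [← iff_of_eq (congrArg (fun u => Tendsto u atTop (𝓝 ((hY n).toLp (Y n))))
    (funext fun N => toLp_sum_smul (Finset.range N) c (fun j : ℕ => hZ (n - (j : ℤ))) (h1 N))), h2]
  refine iff_of_eq (congrArg (fun u => Tendsto u atTop (𝓝 0)) (funext fun N => ?_))
  rw [eLpNorm_sub_comm]
  rfl

lemma arError_eq_norm_sq {X : ℤ → Ω → ℝ} (hX : ∀ n, MemLp (X n) 2 μ) {k : ℕ} (φ : Fin k → ℝ) :
    arError μ X φ =
      ‖(∑ i : Fin k, φ i • toL2 hX ((k : ℤ) - (i : ℤ))) - toL2 hX ((k : ℤ) + 1)‖ ^ 2 := by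
  have h1 : MemLp (fun ω => ∑ i : Fin k, φ i * X ((k : ℤ) - (i : ℤ)) ω) 2 μ :=
    memLp_finsetSum _ fun j _ => (hX _).const_mul _
  simp only [toL2]
  rw [← toLp_sum_smul Finset.univ φ (fun i : Fin k => hX ((k : ℤ) - (i : ℤ))) h1,
    ← MemLp.toLp_sub, ← real_inner_self_eq_norm_sq, inner_toLp]
  simp only [arError, arPredictor, Pi.sub_apply, sq]

lemma IsCentredStationary.autocov_neg {X : ℤ → Ω → ℝ} (h : IsCentredStationary μ X) (n : ℤ) :
    autocov μ X (-n) = autocov μ X n := by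
  have h1 := h.cov_eq n (-n)
  rw [add_neg_cancel, covariance_comm] at h1
  exact h1.symm

variable [IsProbabilityMeasure μ]

lemma IsCentredStationary.inner_toL2 {X : ℤ → Ω → ℝ} (h : IsCentredStationary μ X) (n m : ℤ) :
    ⟪toL2 h.memLp (n + m), toL2 h.memLp n⟫_ℝ = autocov μ X m := by
  rw [toL2, toL2, inner_toLp_eq_cov _ _ (h.mean_zero n), h.cov_eq]

lemma IsWhiteNoise.isNoiseSeq {ε : ℤ → Ω → ℝ} {v : ℝ} (h : IsWhiteNoise μ ε v) :
    IsNoiseSeq (toL2 h.memLp) v := by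
  intro m n
  rw [toL2, toL2, inner_toLp_eq_cov _ _ (h.mean_zero n)]
  split_ifs with hmn
  · rw [hmn, covariance_self (h.memLp n).aemeasurable, h.var_eq]
  · exact h.uncorrelated m n hmn

end L2

/-! ### The rate of the best predictor -/

section Rate

variable {Ω : Type*} [MeasurableSpace Ω] {μ : Measure Ω} [IsProbabilityMeasure μ]
  {X ε : ℤ → Ω → ℝ} {a b : ℕ → ℝ} {d v : ℝ}

lemma DecayUniform.exists_abs_le {c : ℕ → ℝ} {ρ : ℝ} (h : DecayUniform c ρ) :
    ∃ C : ℝ, ∀ j : ℕ, 1 ≤ j → |c j| ≤ C * (j : ℝ) ^ ρ := by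
  obtain ⟨C, hC⟩ := h
  refine ⟨C, fun j hj => ?_⟩
  have hj0 : (0 : ℝ) < j := by exact_mod_cast hj
  have h1 : Tendsto (fun δ : ℝ => C * (j : ℝ) ^ (ρ + δ)) (𝓝[>] 0) (𝓝 (C * (j : ℝ) ^ ρ)) := by
    have h2 : Continuous fun δ : ℝ => C * (j : ℝ) ^ (ρ + δ) :=
      continuous_const.mul (continuous_const.rpow (by fun_prop) fun _ => Or.inl hj0.ne')
    simpa using (h2.tendsto 0).mono_left nhdsWithin_le_nhds
  exact ge_of_tendsto h1 (eventually_mem_nhdsWithin.mono fun δ hδ => hC δ hδ j hj)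

lemma IsLongMemoryModel.existsUnique_isYuleWalker (h : IsLongMemoryModel μ X ε a b d v) (k : ℕ) :
    ∃! φ : Fin k → ℝ, IsYuleWalker (autocov μ X) k φ :=
  LongMemory.existsUnique_isYuleWalker
    ((isFiltered_iff_isNormFiltered h.stationary.memLp h.noise.memLp).1 h.autoregressive)
    ((isFiltered_iff_isNormFiltered h.noise.memLp h.stationary.memLp).1 h.moving_average)
    h.noise.isNoiseSeq h.noise.var_pos h.normalized h.stationary.inner_toL2 k

lemma IsLongMemoryModel.le_arError (h : IsLongMemoryModel μ X ε a b d v) {k : ℕ}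
    (φ : Fin k → ℝ) : v ≤ arError μ X φ := by
  rw [arError_eq_norm_sq h.stationary.memLp]
  exact le_norm_sub_sq
    ((isFiltered_iff_isNormFiltered h.stationary.memLp h.noise.memLp).1 h.autoregressive)
    ((isFiltered_iff_isNormFiltered h.noise.memLp h.stationary.memLp).1 h.moving_average)
    h.noise.isNoiseSeq h.noise.var_pos h.normalized φ k

lemma IsLongMemoryModel.isBigO_rpow (h : IsLongMemoryModel μ X ε a b d v)
    {p q s A B : ℝ} (hp : 1 < p) (hq1 : 1 / 2 < q) (hq2 : q < 1) (hs : 3 - 2 * p - 2 * q ≤ s)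
    (hA : ∀ j : ℕ, 1 ≤ j → |a j| ≤ A * (j : ℝ) ^ (-p))
    (hB : ∀ j : ℕ, 1 ≤ j → |b j| ≤ B * (j : ℝ) ^ (-q))
    {φ : (k : ℕ) → Fin k → ℝ} (hφ : ∀ k, IsYuleWalker (autocov μ X) k (φ k)) :
    (fun k : ℕ => arError μ X (φ k) - v) =O[atTop] (fun k : ℕ => (k : ℝ) ^ s) := by
  obtain ⟨C, hC⟩ := exists_norm_sub_sq_sub_le
    ((isFiltered_iff_isNormFiltered h.stationary.memLp h.noise.memLp).1 h.autoregressive)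
    ((isFiltered_iff_isNormFiltered h.noise.memLp h.stationary.memLp).1 h.moving_average)
    h.noise.isNoiseSeq h.noise.var_pos h.normalized h.stationary.inner_toL2 hp hq1 hq2 hA hB
  refine IsBigO.of_bound |C| ?_
  filter_upwards [eventually_ge_atTop 1] with k hk
  have h1 := hC k hk (φ k) (hφ k) k
  have h2 := h.le_arError (φ k)
  have hk1 : (1 : ℝ) ≤ k := by exact_mod_cast hk
  rw [← arError_eq_norm_sq] at h1
  rw [Real.norm_of_nonneg (sub_nonneg.2 h2), Real.norm_of_nonneg (by positivity)]
  refine h1.trans ?_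
  gcongr
  · exact le_abs_self C

lemma IsLongMemoryModel.isBigO_rpow_add (h : IsLongMemoryModel μ X ε a b d v) (hd0 : 0 < d)
    (hd : d < 1 / 2) {φ : (k : ℕ) → Fin k → ℝ}
    (hφ : ∀ k, IsYuleWalker (autocov μ X) k (φ k)) {δ : ℝ} (hδ : 0 < δ) :
    (fun k : ℕ => arError μ X (φ k) - v) =O[atTop] (fun k : ℕ => (k : ℝ) ^ (-1 + δ)) := by
  -- A loss of `η` in each decay rate costs `4η` in the exponent; `η < d` keeps `a` summable and
  -- `η < 1 / 2 - d` keeps `b` square-summable.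
  obtain ⟨η, hη0, hη1, hη2, hη3⟩ : ∃ η : ℝ, 0 < η ∧ η ≤ δ / 4 ∧ η < d ∧ η < 1 / 2 - d := by
    refine ⟨min (δ / 4) (min (d / 2) ((1 / 2 - d) / 2)), ?_, min_le_left _ _, ?_, ?_⟩
    · exact lt_min (by linarith) (lt_min (by linarith) (by linarith))
    · exact ((min_le_right _ _).trans (min_le_left _ _)).trans_lt (by linarith)
    · exact ((min_le_right _ _).trans (min_le_right _ _)).trans_lt (by linarith)
  obtain ⟨A, hA⟩ := h.decay_a η hη0
  obtain ⟨B, hB⟩ := h.decay_b η hη0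
  refine h.isBigO_rpow (p := 1 + d - η) (q := 1 - d - η) (A := A) (B := B) (by linarith)
    (by linarith) (by linarith) (by linarith) (fun j hj => ?_) (fun j hj => ?_) hφ
  · simpa [show -(1 + d - η) = -d - 1 + η by ring] using hA j hj
  · simpa [show -(1 - d - η) = d - 1 + η by ring] using hB j hj

lemma IsLongMemoryModel.isBigO_inv (h : IsLongMemoryModel μ X ε a b d v) (hd0 : 0 < d)
    (hd : d < 1 / 2) (ha : DecayUniform a (-d - 1)) (hb : DecayUniform b (d - 1))
    {φ : (k : ℕ) → Fin k → ℝ} (hφ : ∀ k, IsYuleWalker (autocov μ X) k (φ k)) :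
    (fun k : ℕ => arError μ X (φ k) - v) =O[atTop] (fun k : ℕ => (k : ℝ)⁻¹) := by
  obtain ⟨A, hA⟩ := ha.exists_abs_le
  obtain ⟨B, hB⟩ := hb.exists_abs_le
  have h1 := h.isBigO_rpow (p := 1 + d) (q := 1 - d) (s := -1) (A := A) (B := B) (by linarith)
    (by linarith) (by linarith) (by linarith) (fun j hj => ?_) (fun j hj => ?_) hφ
  · simpa only [Real.rpow_neg_one] using h1
  · simpa [show -(1 + d) = -d - 1 by ring] using hA j hj
  · simpa [show -(1 - d) = d - 1 by ring] using hB j hj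

end Rate

/-! ### Binomial coefficients -/

section Binomial

lemma binomCoeff_zero (s : ℝ) : binomCoeff s 0 = 1 := by simp [binomCoeff]

lemma add_one_mul_binomCoeff_succ (s : ℝ) (j : ℕ) :
    ((j : ℝ) + 1) * binomCoeff s (j + 1) = (s + j) * binomCoeff s j := by
  have : (j : ℝ) + 1 ≠ 0 := by positivity
  rw [binomCoeff, binomCoeff, Finset.prod_range_succ]
  field_simp

lemma exists_abs_binomCoeff_le {s : ℝ} (hs0 : -1 ≤ s) (hs1 : s ≤ 1) :
    ∃ C : ℝ, 0 ≤ C ∧ ∀ j : ℕ, 1 ≤ j → |binomCoeff s j| ≤ C * (j : ℝ) ^ (s - 1) := by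
  refine ⟨|s| * 2 ^ (1 - s), by positivity, fun j hj => ?_⟩
  have hj0 : (0 : ℝ) < j := by exact_mod_cast hj
  -- The shift of the base from `j` to `j + 1` makes the bound stable under induction.
  suffices h : |binomCoeff s j| ≤ |s| * 2 ^ (1 - s) * ((j : ℝ) + 1) ^ (s - 1) by
    refine h.trans ?_
    gcongr ?_ * ?_
    exact Real.rpow_le_rpow_of_nonpos hj0 (by linarith) (by linarith)
  clear hj0
  induction j, hj using Nat.le_induction with
  | base =>
    have h2 : (2 : ℝ) ^ (1 - s) * 2 ^ (s - 1) = 1 := by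
      rw [← Real.rpow_add (by norm_num)]; simp
    norm_num [binomCoeff]
    rw [mul_assoc, h2, mul_one]
  | succ j hj ih =>
    have hj1 : (1 : ℝ) ≤ j := by exact_mod_cast hj
    have hj2 : (0 : ℝ) < (j : ℝ) + 1 := by positivity
    have hfac : (s + j) / ((j : ℝ) + 1) ≤ (((j : ℝ) + 1 + 1) / ((j : ℝ) + 1)) ^ (s - 1) := by
      calc (s + j) / ((j : ℝ) + 1) = (s - 1) / ((j : ℝ) + 1) + 1 := by field_simp; ring
        _ ≤ Real.exp ((s - 1) / ((j : ℝ) + 1)) := Real.add_one_le_exp _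
        _ = Real.exp (1 / ((j : ℝ) + 1)) ^ (s - 1) := by rw [← Real.exp_mul]; ring_nf
        _ ≤ _ := by
          refine Real.rpow_le_rpow_of_nonpos (by positivity) ?_ (by linarith)
          refine le_trans (le_of_eq ?_) (Real.add_one_le_exp _)
          field_simp; ring
    have hsucc : binomCoeff s (j + 1) = (s + j) / ((j : ℝ) + 1) * binomCoeff s j := by
      rw [div_mul_eq_mul_div, eq_div_iff hj2.ne', ← add_one_mul_binomCoeff_succ, mul_comm]
    rw [hsucc, abs_mul, abs_of_nonneg (div_nonneg (by linarith) hj2.le)]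
    calc (s + j) / ((j : ℝ) + 1) * |binomCoeff s j|
        ≤ (((j : ℝ) + 1 + 1) / ((j : ℝ) + 1)) ^ (s - 1) *
            (|s| * 2 ^ (1 - s) * ((j : ℝ) + 1) ^ (s - 1)) := by gcongr
      _ = |s| * 2 ^ (1 - s) *
            ((((j : ℝ) + 1 + 1) / ((j : ℝ) + 1)) ^ (s - 1) * ((j : ℝ) + 1) ^ (s - 1)) := by ring
      _ = _ := by
        rw [← Real.mul_rpow (by positivity) hj2.le, div_mul_cancel₀ _ hj2.ne']
        push_cast; rfl

lemma decayUniform_binomCoeff {s : ℝ} (hs0 : -1 ≤ s) (hs1 : s ≤ 1) :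
    DecayUniform (binomCoeff s) (s - 1) := by
  obtain ⟨C, hC0, hC⟩ := exists_abs_binomCoeff_le hs0 hs1
  refine ⟨C, fun δ hδ j hj => (hC j hj).trans ?_⟩
  have hj1 : (1 : ℝ) ≤ j := by exact_mod_cast hj
  gcongr
  · linarith

lemma DecayUniform.decayUpTo {c : ℕ → ℝ} {ρ : ℝ} (h : DecayUniform c ρ) : DecayUpTo c ρ :=
  let ⟨C, hC⟩ := h
  fun δ hδ => ⟨C, hC δ hδ⟩

lemma summable_abs_of_le_rpow {c : ℕ → ℝ} {C ρ : ℝ} (hρ : ρ < -1)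
    (h : ∀ j : ℕ, 1 ≤ j → |c j| ≤ C * (j : ℝ) ^ ρ) : Summable fun j => |c j| := by
  refine Summable.of_norm_bounded_eventually_nat ((Real.summable_nat_rpow.2 hρ).mul_left C) ?_
  filter_upwards [eventually_ge_atTop 1] with j hj
  simpa using h j hj

lemma summable_abs_binomCoeff_neg {d : ℝ} (hd0 : 0 < d) (hd : d ≤ 1) :
    Summable fun j => |binomCoeff (-d) j| := by
  obtain ⟨C, -, hC⟩ := exists_abs_binomCoeff_le (s := -d) (by linarith) (by linarith)
  exact summable_abs_of_le_rpow (by linarith) hC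

lemma summable_binomCoeff_sq {d : ℝ} (hd0 : 0 ≤ d) (hd : d < 1 / 2) :
    Summable fun j => binomCoeff d j ^ 2 := by
  obtain ⟨C, -, hC⟩ := exists_abs_binomCoeff_le (s := d) (by linarith) (by linarith)
  have h := summable_abs_of_le_rpow (c := fun j => binomCoeff d j ^ 2) (C := C ^ 2)
    (ρ := (d - 1) * 2) (by linarith) fun j hj => ?_
  · simpa using h
  · rw [abs_pow, Real.rpow_mul j.cast_nonneg, Real.rpow_two, ← mul_pow]
    exact pow_le_pow_left₀ (abs_nonneg _) (hC j hj) 2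

/-- The power series `(1 - z) ^ d` and `(1 - z) ^ (-d)` are inverse to each other. -/
lemma sum_antidiagonal_binomCoeff_neg (d : ℝ) (m : ℕ) :
    ∑ p ∈ Finset.HasAntidiagonal.antidiagonal m, binomCoeff (-d) p.1 * binomCoeff d p.2 =
      if m = 0 then 1 else 0 := by
  set c : ℕ → ℝ := fun m =>
    ∑ p ∈ Finset.HasAntidiagonal.antidiagonal m, binomCoeff (-d) p.1 * binomCoeff d p.2 with hc
  -- Weighting each term by `p.1 + p.2` and shifting the indices gives a recursion for the sums.
  have hrec (m : ℕ) : ((m : ℝ) + 1) * c (m + 1) = m * c m := by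
    have h1 : ∑ p ∈ Finset.HasAntidiagonal.antidiagonal (m + 1),
        (p.1 : ℝ) * (binomCoeff (-d) p.1 * binomCoeff d p.2) =
        ∑ p ∈ Finset.HasAntidiagonal.antidiagonal m,
          (-d + p.1) * (binomCoeff (-d) p.1 * binomCoeff d p.2) := by
      rw [Finset.Nat.sum_antidiagonal_succ]
      simp only [Nat.cast_zero, zero_mul, zero_add]
      refine Finset.sum_congr rfl fun p _ => ?_
      push_cast
      rw [← mul_assoc, add_one_mul_binomCoeff_succ, mul_assoc]
    have h2 : ∑ p ∈ Finset.HasAntidiagonal.antidiagonal (m + 1),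
        (p.2 : ℝ) * (binomCoeff (-d) p.1 * binomCoeff d p.2) =
        ∑ p ∈ Finset.HasAntidiagonal.antidiagonal m,
          (d + p.2) * (binomCoeff (-d) p.1 * binomCoeff d p.2) := by
      rw [Finset.Nat.sum_antidiagonal_succ']
      simp only [Nat.cast_zero, zero_mul, zero_add]
      refine Finset.sum_congr rfl fun p _ => ?_
      push_cast
      rw [mul_left_comm, add_one_mul_binomCoeff_succ, mul_left_comm]
    have h3 (n : ℕ) : (n : ℝ) * c n = ∑ p ∈ Finset.HasAntidiagonal.antidiagonal n,
        ((p.1 : ℝ) + p.2) * (binomCoeff (-d) p.1 * binomCoeff d p.2) := by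
      rw [hc, Finset.mul_sum]
      refine Finset.sum_congr rfl fun p hp => ?_
      rw [← Finset.HasAntidiagonal.mem_antidiagonal.1 hp]; push_cast; rfl
    have h4 := h3 (m + 1)
    push_cast at h4
    rw [h4, h3]
    simp only [add_mul, Finset.sum_add_distrib] at h1 h2 ⊢
    rw [h1, h2]
    simp only [neg_mul, Finset.sum_neg_distrib]
    ring
  change c m = _
  cases m with
  | zero => simp [hc, binomCoeff_zero]
  | succ m =>
    rw [if_neg (Nat.succ_ne_zero m)]
    induction m with
    | zero => simpa using hrec 0
    | succ m ih =>
      have h := hrec (m + 1)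
      rw [ih, mul_zero] at h
      refine (mul_eq_zero.1 h).resolve_left ?_
      positivity

/-- The autocovariances `∑_j b_j b_{j+h}` of fractional noise satisfy a first-order recursion,
because the difference of the two sides telescopes. -/
lemma sum_binomCoeff_mul_shift (d : ℝ) (h N : ℕ) :
    ((h : ℝ) + 1 - d) * ∑ j ∈ Finset.range N, binomCoeff d j * binomCoeff d (j + (h + 1)) =
      (h + d) * (∑ j ∈ Finset.range N, binomCoeff d j * binomCoeff d (j + h)) -
        N * (binomCoeff d N * binomCoeff d (N + h)) := by
  induction N with
  | zero => simp
  | succ N ih =>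
    have h1 := add_one_mul_binomCoeff_succ d N
    have h2 := add_one_mul_binomCoeff_succ d (N + h)
    have h3 : ((N : ℝ) + h + 1) ≠ 0 := by positivity
    rw [Finset.sum_range_succ, Finset.sum_range_succ, mul_add, ih, mul_add]
    push_cast at h2 ⊢
    rw [show ((N : ℝ) + 1) * (binomCoeff d (N + 1) * binomCoeff d (N + 1 + h)) =
      (((N : ℝ) + 1) * binomCoeff d (N + 1)) * binomCoeff d (N + 1 + h) by ring, h1,
      show N + 1 + h = N + (h + 1) by ring]
    have h4 : binomCoeff d (N + (h + 1)) =
        (d + (N + h)) / ((N : ℝ) + h + 1) * binomCoeff d (N + h) := by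
      rw [div_mul_eq_mul_div, eq_div_iff h3, ← h2, mul_comm]; rfl
    rw [h4]
    field_simp
    ring

lemma tendsto_mul_binomCoeff_mul_shift {d : ℝ} (hd0 : 0 ≤ d) (hd : d < 1 / 2) (h : ℕ) :
    Tendsto (fun N : ℕ => (N : ℝ) * (binomCoeff d N * binomCoeff d (N + h))) atTop (𝓝 0) := by
  obtain ⟨C, hC0, hC⟩ := exists_abs_binomCoeff_le (s := d) (by linarith) (by linarith)
  have h1 : Tendsto (fun N : ℕ => C ^ 2 * (N : ℝ) ^ (-(1 - 2 * d))) atTop (𝓝 0) := by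
    have := ((tendsto_rpow_neg_atTop (y := 1 - 2 * d) (by linarith)).comp
      tendsto_natCast_atTop_atTop).const_mul (C ^ 2)
    simpa using this
  refine squeeze_zero_norm' ?_ h1
  filter_upwards [eventually_ge_atTop 1] with N hN
  have hN0 : (0 : ℝ) < N := by exact_mod_cast hN
  rw [Real.norm_eq_abs, abs_mul, abs_mul, abs_of_pos hN0]
  have h2 : |binomCoeff d (N + h)| ≤ C * (N : ℝ) ^ (d - 1) := by
    refine (hC (N + h) (by omega)).trans ?_
    gcongr ?_ * ?_
    exact Real.rpow_le_rpow_of_nonpos hN0 (by push_cast; simp) (by linarith)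
  calc (N : ℝ) * (|binomCoeff d N| * |binomCoeff d (N + h)|)
      ≤ N * ((C * (N : ℝ) ^ (d - 1)) * (C * (N : ℝ) ^ (d - 1))) := by
        gcongr
        exact hC N hN
    _ = C ^ 2 * ((N : ℝ) ^ (1 : ℝ) * (N : ℝ) ^ (d - 1) * (N : ℝ) ^ (d - 1)) := by
        rw [Real.rpow_one]; ring
    _ = _ := by rw [← Real.rpow_add hN0, ← Real.rpow_add hN0]; ring_nf

end Binomial

/-! ### Inversion of a linear filter -/

section Inversion

open scoped InnerProductSpace

variable {H : Type*} [NormedAddCommGroup H] [InnerProductSpace ℝ H]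

lemma IsNormFiltered.inner_add_eq {b : ℕ → ℝ} {e x : ℤ → H} {v : ℝ} (hb : IsNormFiltered b e x)
    (he : IsNoiseSeq e v) (n m h : ℤ) : ⟪x (n + h), x n⟫_ℝ = ⟪x (m + h), x m⟫_ℝ := by
  obtain ⟨k, rfl | rfl⟩ := h.eq_nat_or_neg
  · exact tendsto_nhds_unique (hb.tendsto_inner_shift he n k) (hb.tendsto_inner_shift he m k)
  · have h1 := hb.tendsto_inner_shift he (n + -(k : ℤ)) k
    have h2 := hb.tendsto_inner_shift he (m + -(k : ℤ)) k
    rw [neg_add_cancel_right, real_inner_comm] at h1 h2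
    exact tendsto_nhds_unique h1 h2

/-- If `a` is absolutely summable and convolution inverse to `b`, then the filter `a` inverts the
filter `b`. The vector `∑ a j • x (n - j)` lies in the closed span of `e`, and its inner
products with the orthogonal sequence `e` are those of `e n`. -/
lemma IsNormFiltered.inverse [CompleteSpace H] {a b : ℕ → ℝ} {e x : ℤ → H} {v : ℝ}
    (hb : IsNormFiltered b e x) (he : IsNoiseSeq e v) (ha : Summable fun j => |a j|)
    (hab : ∀ m : ℕ, ∑ p ∈ Finset.HasAntidiagonal.antidiagonal m, a p.1 * b p.2 =
      if m = 0 then 1 else 0) :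
    IsNormFiltered a x e := by
  intro n
  have hnorm (m : ℤ) : ‖x m‖ = ‖x 0‖ := by
    have h1 := hb.inner_add_eq he m 0 0
    simp only [add_zero, real_inner_self_eq_norm_sq] at h1
    exact (pow_left_inj₀ (norm_nonneg _) (norm_nonneg _) two_ne_zero).1 h1
  have hsum : Summable fun j : ℕ => a j • x (n - (j : ℤ)) := by
    refine Summable.of_norm ?_
    simp only [norm_smul, hnorm, Real.norm_eq_abs]
    exact ha.mul_right _
  obtain ⟨y, hy⟩ := hsum
  have hlim := hy.tendsto_sum_nat
  suffices h : y = e n by rwa [h] at hlim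
  set K := Submodule.span ℝ (Set.range e) with hK
  have heK (m : ℤ) : e m ∈ K.topologicalClosure :=
    K.le_topologicalClosure (Submodule.subset_span ⟨m, rfl⟩)
  have hclosed : IsClosed (K.topologicalClosure : Set H) := K.isClosed_topologicalClosure
  have hxK (m : ℤ) : x m ∈ K.topologicalClosure :=
    hclosed.mem_of_tendsto (hb m) (Eventually.of_forall fun N =>
      Submodule.sum_mem _ fun j _ => Submodule.smul_mem _ _ (heK _))
  have hyK : y ∈ K.topologicalClosure :=
    hclosed.mem_of_tendsto hlim (Eventually.of_forall fun N =>
      Submodule.sum_mem _ fun j _ => Submodule.smul_mem _ _ (hxK _))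
  have hinner (m : ℤ) : ⟪e m, y⟫_ℝ = ⟪e m, e n⟫_ℝ := by
    have hc := (continuous_const.inner continuous_id).tendsto y (f := fun z : H => ⟪e m, z⟫_ℝ)
    have h1 := hc.comp hlim
    refine tendsto_nhds_unique h1 (tendsto_const_nhds.congr' ?_)
    rcases lt_or_ge n m with hnm | hmn
    · refine Eventually.of_forall fun N => ?_
      simp only [Function.comp_apply, inner_sum, inner_smul_right]
      rw [he, if_neg (by omega)]
      refine (Finset.sum_eq_zero fun j _ => ?_).symm
      rw [hb.inner_noise_of_lt he (by omega), mul_zero]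
    · obtain ⟨i, rfl⟩ : ∃ i : ℕ, m = n - i := ⟨(n - m).toNat, by omega⟩
      filter_upwards [eventually_ge_atTop (i + 1)] with N hN
      simp only [Function.comp_apply, inner_sum, inner_smul_right]
      rw [← Finset.sum_subset (Finset.range_subset_range.2 hN)]
      · have h2 := hab i
        rw [Finset.Nat.sum_antidiagonal_eq_sum_range_succ (fun j l => a j * b l)] at h2
        have h3 : ∀ j ∈ Finset.range (i + 1), a j * ⟪e (n - i), x (n - j)⟫_ℝ =
            a j * b (i - j) * v := by
          intro j hj
          have hji : j ≤ i := Nat.lt_succ_iff.1 (Finset.mem_range.1 hj)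
          have h4 := hb.inner_noise_of_le he (n - j) (i - j)
          rw [show n - (j : ℤ) - ((i - j : ℕ) : ℤ) = n - i by push_cast [hji]; ring] at h4
          rw [h4, mul_assoc]
        rw [Finset.sum_congr rfl h3, ← Finset.sum_mul, h2, he]
        rcases Nat.eq_zero_or_pos i with rfl | hi
        · simp
        · rw [if_neg (by omega), if_neg (by omega), zero_mul]
      · intro j _ hj
        rw [Finset.mem_range] at hj
        rw [hb.inner_noise_of_lt he (by omega), mul_zero]
  have horth : y - e n ∈ Kᗮ := by
    rw [Submodule.mem_orthogonal]
    intro u hu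
    induction hu using Submodule.span_induction with
    | mem u hu =>
      obtain ⟨m, rfl⟩ := hu
      rw [inner_sub_right, hinner, sub_self]
    | zero => simp
    | add u w _ _ h1 h2 => rw [inner_add_left, h1, h2, add_zero]
    | smul c u _ h1 => rw [real_inner_smul_left, h1, mul_zero]
  rw [← Submodule.orthogonal_closure] at horth
  have h0 := Submodule.inner_right_of_mem_orthogonal
    (Submodule.sub_mem _ hyK (heK n)) horth
  exact sub_eq_zero.1 (inner_self_eq_zero.1 h0)

end Inversion

/-! ### The Levinson recursion for fractional noise -/

section Levinson

variable {d : ℝ} {γ : ℤ → ℝ}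

lemma intCast_sub_ne_zero (hd0 : 0 < d) (hd : d < 1) (m : ℤ) : (m : ℝ) - d ≠ 0 := by
  intro h
  have h1 : (0 : ℝ) < m := by linarith
  have h2 : (m : ℝ) < 1 := by linarith
  norm_cast at h1 h2
  omega

lemma intCast_add_ne_zero (hd0 : 0 < d) (hd : d < 1) (m : ℤ) : (m : ℝ) + d ≠ 0 := by
  intro h
  refine intCast_sub_ne_zero hd0 hd (-m) ?_
  push_cast; linarith

/-- By symmetry the recursion for the autocovariances at nonnegative lags extends to all of `ℤ`. -/
lemma recursion_of_nat (heven : ∀ n, γ (-n) = γ n)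
    (hrec : ∀ h : ℕ, ((h : ℝ) + 1 - d) * γ (h + 1) = (h + d) * γ h) (n : ℤ) :
    ((n : ℝ) - d) * γ n = (n - 1 + d) * γ (n - 1) := by
  rcases lt_or_ge 0 n with hn | hn
  · obtain ⟨h, rfl⟩ : ∃ h : ℕ, n = h + 1 := ⟨(n - 1).toNat, by omega⟩
    have := hrec h
    push_cast
    rw [add_sub_cancel_right, add_sub_cancel_right]
    exact this
  · obtain ⟨h, rfl⟩ : ∃ h : ℕ, n = -h := ⟨(-n).toNat, by omega⟩
    have := hrec h
    rw [heven, show -(h : ℤ) - 1 = -((h : ℤ) + 1) by ring, heven]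
    push_cast
    linarith

/-- The recursion, iterated `k` times. -/
lemma mul_prod_inv_eq (hd0 : 0 < d) (hd : d < 1)
    (hrec : ∀ n : ℤ, ((n : ℝ) - d) * γ n = (n - 1 + d) * γ (n - 1)) (n : ℤ) (k : ℕ) :
    γ n * ∏ i ∈ Finset.range k, ((n : ℝ) - 1 - i + d)⁻¹ =
      γ (n - k) * ∏ i ∈ Finset.range k, ((n : ℝ) - i - d)⁻¹ := by
  induction k with
  | zero => simp
  | succ k ih =>
    have h1 := hrec (n - k)
    have h2 := intCast_sub_ne_zero hd0 hd (n - k)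
    have h3 := intCast_add_ne_zero hd0 hd (n - 1 - k)
    push_cast at h1 h2 h3
    rw [Finset.prod_range_succ, Finset.prod_range_succ, ← mul_assoc, ih]
    have h4 : γ (n - k) = ((n : ℝ) - k - d)⁻¹ * (((n : ℝ) - 1 - k + d) * γ (n - (k + 1 : ℕ))) := by
      rw [eq_inv_mul_iff_mul_eq₀ h2, h1]
      push_cast
      rw [show n - ((k : ℤ) + 1) = n - k - 1 by ring]
      ring
    rw [h4]
    field_simp

/-- The factor `c_k` in the closed form of the forward prediction errors. -/
noncomputable def levinsonFactor (d : ℝ) (k : ℕ) : ℝ :=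
  ∏ i ∈ Finset.range k, ((i : ℝ) + 1 - 2 * d) / (i + 1 - d)

/-- The covariance of `x n` with the error of the best prediction of `x 0` from
`x 1, …, x k`, for a process with autocovariance function `γ` satisfying
`(n - d) γ n = (n - 1 + d) γ (n - 1)`. -/
noncomputable def levinsonCov (d : ℝ) (γ : ℤ → ℝ) (k : ℕ) (n : ℤ) : ℝ :=
  levinsonFactor d k * (γ (n - k) * ∏ i ∈ Finset.range k, ((n : ℝ) - 1 - i) * ((n : ℝ) - i - d)⁻¹)

/-- The closed form satisfies the Levinson recursion with partial autocorrelation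
`d / (k + 1 - d)`. -/
lemma levinsonCov_succ (hd0 : 0 < d) (hd : d < 1) (heven : ∀ n, γ (-n) = γ n)
    (hrec : ∀ n : ℤ, ((n : ℝ) - d) * γ n = (n - 1 + d) * γ (n - 1)) (k : ℕ) (n : ℤ) :
    levinsonCov d γ (k + 1) n =
      levinsonCov d γ k n - d / ((k : ℝ) + 1 - d) * levinsonCov d γ k (k + 1 - n) := by
  set P := ∏ i ∈ Finset.range k, ((n : ℝ) - 1 - i) with hP
  set D := ∏ i ∈ Finset.range k, ((n : ℝ) - 1 - i - d)⁻¹ with hD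
  have hn := intCast_sub_ne_zero hd0 hd n
  have hk := intCast_sub_ne_zero hd0 hd (k + 1)
  have hnk := intCast_sub_ne_zero hd0 hd (n - k)
  push_cast at hk hnk
  have hshift : ∏ i ∈ Finset.range (k + 1), ((n : ℝ) - i - d)⁻¹ = ((n : ℝ) - d)⁻¹ * D := by
    rw [Finset.prod_range_succ', mul_comm]
    congr 1
    · simp
    · refine Finset.prod_congr rfl fun i _ => ?_
      push_cast; congr 1; ring
  have hsucc : levinsonCov d γ (k + 1) n = levinsonFactor d k *
      (((k : ℝ) + 1 - 2 * d) / (k + 1 - d)) *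
        (γ (n - 1 - k) * (P * ((n : ℝ) - 1 - k) * (((n : ℝ) - d)⁻¹ * D))) := by
    rw [levinsonCov, levinsonFactor, Finset.prod_range_succ, ← levinsonFactor,
      Finset.prod_mul_distrib, hshift, Finset.prod_range_succ]
    push_cast
    rw [show n - ((k : ℤ) + 1) = n - 1 - k by ring]
  have hfwd : levinsonCov d γ k n = levinsonFactor d k *
      ((((n : ℝ) - k - 1 + d) * γ (n - 1 - k)) * (P * (((n : ℝ) - d)⁻¹ * D))) := by
    rw [levinsonCov, Finset.prod_mul_distrib, ← hshift, Finset.prod_range_succ]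
    have h1 := hrec (n - k)
    push_cast at h1
    rw [show n - 1 - (k : ℤ) = n - k - 1 by ring, ← h1, ← hP]
    generalize ∏ i ∈ Finset.range k, ((n : ℝ) - i - d)⁻¹ = Q
    field_simp
  have hbwd : levinsonCov d γ k (k + 1 - n) =
      levinsonFactor d k * (γ (n - 1 - k) * (P * D)) := by
    have h1 := mul_prod_inv_eq hd0 hd hrec (n - 1) k
    have h2 : ∏ i ∈ Finset.range k, ((((k : ℤ) + 1 - n : ℤ) : ℝ) - 1 - i) *
        ((((k : ℤ) + 1 - n : ℤ) : ℝ) - i - d)⁻¹ =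
        P * ∏ i ∈ Finset.range k, (((n - 1 : ℤ) : ℝ) - 1 - i + d)⁻¹ := by
      rw [← Finset.prod_range_reflect, hP, ← Finset.prod_mul_distrib]
      refine Finset.prod_congr rfl fun i hi => ?_
      have hik : i + 1 ≤ k := Finset.mem_range.1 hi
      have h3 : ((k - 1 - i : ℕ) : ℝ) = k - 1 - i := by
        rw [Nat.cast_sub (by omega), Nat.cast_sub (by omega)]; simp
      push_cast
      rw [h3, show (k : ℝ) + 1 - n - 1 - (k - 1 - i) = -((n : ℝ) - 1 - i) by ring,
        show (k : ℝ) + 1 - n - (k - 1 - i) - d = -((n : ℝ) - 1 - 1 - i + d) by ring,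
        inv_neg, neg_mul_neg]
    rw [levinsonCov, h2, show (k : ℤ) + 1 - n - k = -(n - 1) by ring, heven]
    push_cast at h1 ⊢
    rw [← hD] at h1
    linear_combination (levinsonFactor d k * P) * h1
  rw [hsucc, hfwd, hbwd]
  field_simp
  ring

/-- There is a prediction error filter `P` of order `k` whose output has covariances
`levinsonCov d γ k` with the process; the reversed filter supplies the Levinson update. -/
lemma exists_predictionErrorFilter (hd0 : 0 < d) (hd : d < 1) (heven : ∀ n, γ (-n) = γ n)
    (hrec : ∀ n : ℤ, ((n : ℝ) - d) * γ n = (n - 1 + d) * γ (n - 1)) (k : ℕ) :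
    ∃ P : ℕ → ℝ, P 0 = 1 ∧ (∀ j, k < j → P j = 0) ∧
      ∀ n : ℤ, ∑ j ∈ Finset.range (k + 1), P j * γ (n - j) = levinsonCov d γ k n := by
  induction k with
  | zero =>
    refine ⟨fun j => if j = 0 then 1 else 0, by simp, fun j hj => if_neg hj.ne', fun n => ?_⟩
    simp [levinsonCov, levinsonFactor]
  | succ k ih =>
    obtain ⟨P, hP0, hPk, hP⟩ := ih
    refine ⟨fun j => if j ≤ k + 1 then P j - d / ((k : ℝ) + 1 - d) * P (k + 1 - j) else 0,
      ?_, fun j hj => if_neg (by omega), fun n => ?_⟩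
    · simp [hP0, hPk (k + 1) (Nat.lt_succ_self k)]
    · have h1 : ∑ j ∈ Finset.range (k + 1 + 1), P j * γ (n - j) = levinsonCov d γ k n := by
        rw [Finset.sum_range_succ, hPk (k + 1) (Nat.lt_succ_self k), zero_mul, add_zero, hP]
      have h2 : ∑ j ∈ Finset.range (k + 1 + 1), P (k + 1 - j) * γ (n - j) =
          levinsonCov d γ k (k + 1 - n) := by
        rw [← hP, ← add_zero (∑ j ∈ Finset.range (k + 1), _),
          ← zero_mul (γ ((k : ℤ) + 1 - n - ((k + 1 : ℕ) : ℤ))), ← hPk (k + 1) (Nat.lt_succ_self k),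
          ← Finset.sum_range_succ (fun j : ℕ => P j * γ ((k : ℤ) + 1 - n - j)),
          ← Finset.sum_range_reflect]
        refine Finset.sum_congr rfl fun j hj => ?_
        have hjk : j ≤ k + 1 := Nat.lt_succ_iff.1 (Finset.mem_range.1 hj)
        rw [show k + 1 + 1 - 1 - j = k + 1 - j by omega, ← heven]
        congr 2
        · omega
        · push_cast [hjk]; ring
      rw [levinsonCov_succ hd0 hd heven hrec, ← h1, ← h2, Finset.mul_sum, ← Finset.sum_sub_distrib]
      refine Finset.sum_congr rfl fun j hj => ?_
      dsimp only
      rw [if_pos (Nat.lt_succ_iff.1 (Finset.mem_range.1 hj))]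
      ring

/-- The Yule–Walker equations of every order have a solution with prediction error
`levinsonCov d γ k 0`. -/
lemma exists_isYuleWalker_error_eq (hd0 : 0 < d) (hd : d < 1) (heven : ∀ n, γ (-n) = γ n)
    (hrec : ∀ n : ℤ, ((n : ℝ) - d) * γ n = (n - 1 + d) * γ (n - 1)) (k : ℕ) :
    ∃ φ : Fin k → ℝ, IsYuleWalker γ k φ ∧
      γ 0 - ∑ i : Fin k, φ i * γ ((i : ℤ) + 1) = levinsonCov d γ k 0 := by
  obtain ⟨P, hP0, -, hP⟩ := exists_predictionErrorFilter hd0 hd heven hrec k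
  have hsum (n : ℤ) : γ n - ∑ i : Fin k, -P (i + 1) * γ ((i : ℤ) + 1 - n) =
      levinsonCov d γ k n := by
    rw [← hP, Finset.sum_range_succ', hP0, Fin.sum_univ_eq_sum_range
      (fun i : ℕ => -P (i + 1) * γ ((i : ℤ) + 1 - n)) k]
    simp only [neg_mul, Finset.sum_neg_distrib, sub_neg_eq_add, one_mul, Nat.cast_zero, sub_zero]
    rw [add_comm]
    congr 1
    refine Finset.sum_congr rfl fun i _ => ?_
    rw [← heven (n - _)]
    congr 2
    push_cast; ring
  refine ⟨fun i => -P (i + 1), fun j => ?_, by simpa using hsum 0⟩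
  have h1 := hsum ((j : ℤ) + 1)
  have h2 : levinsonCov d γ k ((j : ℤ) + 1) = 0 := by
    rw [levinsonCov, Finset.prod_eq_zero (Finset.mem_range.2 j.isLt), mul_zero, mul_zero]
    push_cast; ring
  rw [h2, sub_eq_zero] at h1
  rw [h1]
  refine Finset.sum_congr rfl fun i _ => ?_
  congr 2; ring

lemma levinsonCov_succ_zero (hd0 : 0 < d) (hd : d < 1) (heven : ∀ n, γ (-n) = γ n)
    (hrec : ∀ n : ℤ, ((n : ℝ) - d) * γ n = (n - 1 + d) * γ (n - 1)) (k : ℕ) :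
    levinsonCov d γ (k + 1) 0 =
      levinsonCov d γ k 0 * (1 - d ^ 2 / ((k : ℝ) + 1 - d) ^ 2) := by
  have h1 := hrec (k + 1)
  have h2 := intCast_sub_ne_zero hd0 hd (k + 1)
  have h3 : (k : ℝ) + d ≠ 0 := by positivity
  push_cast at h1 h2
  rw [add_sub_cancel_right, add_sub_cancel_right] at h1
  rw [levinsonCov, levinsonCov, levinsonFactor, Finset.prod_range_succ, ← levinsonFactor,
    Finset.prod_range_succ]
  simp only [zero_sub, heven]
  push_cast
  have h4 : γ ((k : ℤ) + 1) = ((k : ℝ) + 1 - d)⁻¹ * ((k + d) * γ k) := by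
    rw [← h1, inv_mul_cancel_left₀ h2]
  rw [h4, show (0 : ℝ) - k - d = -(k + d) by ring, inv_neg, show (0 : ℝ) - 1 - k = -(k + 1) by ring,
    neg_mul_neg]
  field_simp
  ring

/-! ### The asymptotics of the prediction error -/

/-- A sequence that decreases to `v > 0` by the factors `1 - d² / (k + 1 - d)²` satisfies
`s k - v ∼ d² v / k`. -/
lemma isEquivalent_of_succ_eq (hd0 : 0 < d) (hd : d < 1 / 2) {s : ℕ → ℝ} {v : ℝ} (hv : 0 < v)
    (hs : ∀ k, s (k + 1) = s k * (1 - d ^ 2 / ((k : ℝ) + 1 - d) ^ 2))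
    (hle : ∀ k, v ≤ s k) (hlim : Tendsto s atTop (𝓝 v)) :
    (fun k => s k - v) ~[atTop] fun k : ℕ => d ^ 2 * v * (k : ℝ)⁻¹ := by
  have hstep (k : ℕ) : s k - s (k + 1) = s k * (d ^ 2 / ((k : ℝ) + 1 - d) ^ 2) := by
    rw [hs]; ring
  have hanti : Antitone s := antitone_nat_of_succ_le fun k => by
    have h1 := hstep k
    have h2 : 0 ≤ s k * (d ^ 2 / ((k : ℝ) + 1 - d) ^ 2) :=
      mul_nonneg (hv.le.trans (hle k)) (by positivity)
    linarith
  -- Both bounds compare `1 / (k + 1 - d) ^ 2` with telescoping differences.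
  have hlow (k : ℕ) : v * d ^ 2 * ((k : ℝ) + (1 - d))⁻¹ ≤ s k - v := by
    have hmono : Antitone fun m : ℕ => s m - v * d ^ 2 * ((m : ℝ) + (1 - d))⁻¹ := by
      refine antitone_nat_of_succ_le fun m => ?_
      have hm : (0 : ℝ) < (m : ℝ) + (1 - d) := by have := m.cast_nonneg (α := ℝ); linarith
      have h1 : ((m : ℝ) + (1 - d))⁻¹ - (((m + 1 : ℕ) : ℝ) + (1 - d))⁻¹ ≤
          1 / ((m : ℝ) + 1 - d) ^ 2 := by
        push_cast
        rw [show (m : ℝ) + 1 - d = m + (1 - d) by ring,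
          show (m : ℝ) + 1 + (1 - d) = m + (1 - d) + 1 by ring]
        generalize (m : ℝ) + (1 - d) = t at hm
        rw [inv_eq_one_div, inv_eq_one_div, div_sub_div _ _ hm.ne' (by positivity),
          div_le_div_iff₀ (by positivity) (by positivity)]
        nlinarith
      have h2 : v * (d ^ 2 / ((m : ℝ) + 1 - d) ^ 2) ≤ s m - s (m + 1) := by
        rw [hstep]
        gcongr
        exact hle m
      have h3 := mul_le_mul_of_nonneg_left h1 (by positivity : 0 ≤ v * d ^ 2)
      rw [mul_sub, mul_one_div, mul_div_assoc] at h3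
      linarith
    have hl : Tendsto (fun m : ℕ => s m - v * d ^ 2 * ((m : ℝ) + (1 - d))⁻¹) atTop (𝓝 v) := by
      have h1 : Tendsto (fun m : ℕ => ((m : ℝ) + (1 - d))⁻¹) atTop (𝓝 0) :=
        tendsto_inv_atTop_zero.comp
          (tendsto_atTop_add_const_right _ _ tendsto_natCast_atTop_atTop)
      simpa using hlim.sub (h1.const_mul (v * d ^ 2))
    have := hmono.le_of_tendsto hl k
    linarith
  have hupp (k : ℕ) : s k - v ≤ s k * d ^ 2 * ((k : ℝ) + (1 / 2 - d))⁻¹ := by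
    have hpos (m : ℕ) : (0 : ℝ) < (m : ℝ) + (1 / 2 - d) := by
      have := m.cast_nonneg (α := ℝ); linarith
    have hind (m : ℕ) (hm : k ≤ m) : s k - s m ≤
        s k * d ^ 2 * (((k : ℝ) + (1 / 2 - d))⁻¹ - ((m : ℝ) + (1 / 2 - d))⁻¹) := by
      induction m, hm using Nat.le_induction with
      | base => simp
      | succ m hm ih =>
        have h1 : 1 / ((m : ℝ) + 1 - d) ^ 2 ≤
            ((m : ℝ) + (1 / 2 - d))⁻¹ - (((m + 1 : ℕ) : ℝ) + (1 / 2 - d))⁻¹ := by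
          have hm := hpos m
          push_cast
          rw [show (m : ℝ) + 1 - d = m + (1 / 2 - d) + 1 / 2 by ring,
            show (m : ℝ) + 1 + (1 / 2 - d) = m + (1 / 2 - d) + 1 by ring]
          generalize (m : ℝ) + (1 / 2 - d) = t at hm
          rw [inv_eq_one_div, inv_eq_one_div, div_sub_div _ _ hm.ne' (by positivity),
            div_le_div_iff₀ (by positivity) (by positivity)]
          nlinarith
        have hsk : 0 ≤ s k := hv.le.trans (hle k)
        have h2 : s m - s (m + 1) ≤ s k * (d ^ 2 / ((m : ℝ) + 1 - d) ^ 2) := by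
          rw [hstep]
          gcongr
          exact hanti hm
        have h3 := mul_le_mul_of_nonneg_left h1 (by positivity : 0 ≤ s k * d ^ 2)
        rw [mul_one_div, mul_div_assoc] at h3
        linarith
    refine le_of_tendsto (tendsto_const_nhds.sub hlim) ?_
    filter_upwards [eventually_ge_atTop k] with m hm
    refine (hind m hm).trans ?_
    have hsk : 0 ≤ s k := hv.le.trans (hle k)
    have := hpos m
    gcongr
    have : 0 ≤ ((m : ℝ) + (1 / 2 - d))⁻¹ := by positivity
    linarith
  have hne : ∀ᶠ k : ℕ in atTop, d ^ 2 * v * (k : ℝ)⁻¹ ≠ 0 := by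
    filter_upwards [eventually_gt_atTop 0] with k hk
    have : (0 : ℝ) < k := by exact_mod_cast hk
    positivity
  rw [isEquivalent_iff_tendsto_one hne]
  have hl1 : Tendsto (fun k : ℕ => (k : ℝ) / (k + (1 - d))) atTop (𝓝 1) :=
    tendsto_natCast_div_add_atTop (1 - d)
  have hl2 : Tendsto (fun k : ℕ => s k / v * ((k : ℝ) / (k + (1 / 2 - d)))) atTop (𝓝 1) := by
    have := (hlim.div_const v).mul (tendsto_natCast_div_add_atTop (𝕜 := ℝ) (1 / 2 - d))
    rwa [div_self hv.ne', one_mul] at this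
  refine tendsto_of_tendsto_of_tendsto_of_le_of_le' hl1 hl2 ?_ ?_
  · filter_upwards [eventually_gt_atTop 0] with k hk
    have hk0 : (0 : ℝ) < k := by exact_mod_cast hk
    have hk1 : (0 : ℝ) < (k : ℝ) + (1 - d) := by linarith
    rw [Pi.div_apply, le_div_iff₀ (by positivity)]
    refine le_trans (le_of_eq ?_) (hlow k)
    field_simp
  · filter_upwards [eventually_gt_atTop 0] with k hk
    have hk0 : (0 : ℝ) < k := by exact_mod_cast hk
    have hk1 : (0 : ℝ) < (k : ℝ) + (1 / 2 - d) := by linarith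
    rw [Pi.div_apply, div_le_iff₀ (by positivity)]
    refine (hupp k).trans (le_of_eq ?_)
    field_simp

end Levinson

/-! ### Fractional noise -/

section FractionalNoise

open scoped InnerProductSpace

variable {Ω : Type*} [MeasurableSpace Ω] {μ : Measure Ω} [IsProbabilityMeasure μ]
  {X ε : ℤ → Ω → ℝ} {d v : ℝ}

/-- A moving average of white noise is centred and stationary. -/
lemma IsFiltered.isCentredStationary {b : ℕ → ℝ} (h : IsFiltered μ b ε X)
    (hε : IsWhiteNoise μ ε v) (hX : ∀ n, MemLp (X n) 2 μ) : IsCentredStationary μ X := by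
  have hb := (isFiltered_iff_isNormFiltered hε.memLp hX).1 h
  have hmean (n : ℤ) : ∫ ω, X n ω ∂μ = 0 := by
    have h1 := hb.tendsto_inner ((memLp_const (1 : ℝ)).toLp (fun _ : Ω => (1 : ℝ))) n
    simp only [toL2, inner_toLp, one_mul, hε.mean_zero, mul_zero, Finset.sum_const_zero] at h1
    exact tendsto_nhds_unique h1 tendsto_const_nhds
  refine ⟨hX, hmean, fun n m => ?_⟩
  have h1 := hb.inner_add_eq hε.isNoiseSeq n 0 m
  rw [zero_add] at h1
  simp only [toL2, inner_toLp_eq_cov _ _ (hmean _)] at h1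
  exact h1

lemma IsFractionalNoise.autocov_succ (h : IsFractionalNoise μ X ε d v) (hd0 : 0 ≤ d)
    (hd : d < 1 / 2) (m : ℕ) :
    ((m : ℝ) + 1 - d) * autocov μ X (m + 1) = (m + d) * autocov μ X m := by
  have hst := h.moving_average.isCentredStationary h.noise h.memLp
  have hb := (isFiltered_iff_isNormFiltered h.noise.memLp h.memLp).1 h.moving_average
  have hlim (i : ℕ) := hb.tendsto_inner_shift h.noise.isNoiseSeq 0 i
  have h1 := (hlim (m + 1)).const_mul ((m : ℝ) + 1 - d)
  have h2 := ((hlim m).const_mul ((m : ℝ) + d)).sub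
    ((tendsto_mul_binomCoeff_mul_shift hd0 hd m).const_mul v)
  rw [hst.inner_toL2] at h1 h2
  rw [mul_zero, sub_zero] at h2
  push_cast at h1
  refine tendsto_nhds_unique h1 (h2.congr fun N => ?_)
  have h3 := sum_binomCoeff_mul_shift d m N
  linear_combination -v * h3

lemma IsFractionalNoise.autoregressive (h : IsFractionalNoise μ X ε d v) (hd0 : 0 < d)
    (hd : d ≤ 1) : IsFiltered μ (binomCoeff (-d)) X ε :=
  (isFiltered_iff_isNormFiltered h.memLp h.noise.memLp).2 <|
    ((isFiltered_iff_isNormFiltered h.noise.memLp h.memLp).1 h.moving_average).inverse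
      h.noise.isNoiseSeq (summable_abs_binomCoeff_neg hd0 hd) (sum_antidiagonal_binomCoeff_neg d)

lemma IsFractionalNoise.autocov_zero_pos (h : IsFractionalNoise μ X ε d v) (hd0 : 0 < d)
    (hd : d ≤ 1) : 0 < autocov μ X 0 := by
  have hst := h.moving_average.isCentredStationary h.noise h.memLp
  have h1 := le_norm_sub_sq
    ((isFiltered_iff_isNormFiltered h.memLp h.noise.memLp).1 (h.autoregressive hd0 hd))
    ((isFiltered_iff_isNormFiltered h.noise.memLp h.memLp).1 h.moving_average)
    h.noise.isNoiseSeq h.noise.var_pos (binomCoeff_zero _) (Fin.elim0 : Fin 0 → ℝ) 0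
  rw [Finset.univ_eq_empty, Finset.sum_empty, zero_sub, norm_neg,
    ← real_inner_self_eq_norm_sq] at h1
  have h2 := hst.inner_toL2 (0 + 1) 0
  rw [add_zero] at h2
  exact h.noise.var_pos.trans_le (h1.trans_eq h2)

/-- By the recursion, `m * γ m` is nondecreasing for `m ≥ 1`, so `γ m ≥ γ 1 / m`. -/
lemma IsFractionalNoise.not_summable_autocov (h : IsFractionalNoise μ X ε d v) (hd0 : 0 < d)
    (hd : d < 1 / 2) : ¬ Summable fun n : ℤ => |autocov μ X n| := by
  have hrec := h.autocov_succ hd0.le hd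
  have hpos : 0 < autocov μ X 1 := by
    have h0 := h.autocov_zero_pos hd0 (by linarith)
    have h1 := hrec 0
    simp only [Nat.cast_zero, zero_add] at h1
    exact pos_of_mul_pos_right (h1 ▸ mul_pos hd0 h0) (by linarith)
  have hmono (m : ℕ) (hm : 1 ≤ m) : autocov μ X 1 ≤ m * autocov μ X m := by
    induction m, hm using Nat.le_induction with
    | base => simp
    | succ m hm ih =>
      have hm1 : (1 : ℝ) ≤ m := by exact_mod_cast hm
      have hγ : 0 < autocov μ X m := pos_of_mul_pos_right (hpos.trans_le ih) (by linarith)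
      have hm2 : (0 : ℝ) < (m : ℝ) + 1 - d := by linarith
      refine ih.trans ?_
      push_cast
      rw [← mul_le_mul_iff_right₀ hm2, mul_left_comm _ ((m : ℝ) + 1), hrec]
      nlinarith [mul_pos (by positivity : (0 : ℝ) < 2 * m * d + d) hγ]
  intro hsum
  have h1 : Summable fun m : ℕ => |autocov μ X m| := hsum.comp_injective Nat.cast_injective
  refine Real.not_summable_natCast_inv ?_
  refine Summable.of_norm_bounded_eventually_nat (h1.mul_left (autocov μ X 1)⁻¹) ?_
  filter_upwards [eventually_ge_atTop 1] with m hm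
  have hm0 : (0 : ℝ) < m := by exact_mod_cast hm
  rw [Real.norm_of_nonneg (by positivity), inv_mul_eq_div, le_div_iff₀ hpos,
    inv_mul_le_iff₀ hm0]
  exact (hmono m hm).trans (by gcongr; exact le_abs_self _)

lemma IsFractionalNoise.isLongMemoryModel (h : IsFractionalNoise μ X ε d v) (hd0 : 0 < d)
    (hd : d < 1 / 2) : IsLongMemoryModel μ X ε (binomCoeff (-d)) (binomCoeff d) d v where
  stationary := h.moving_average.isCentredStationary h.noise h.memLp
  noise := h.noise
  long_memory := h.not_summable_autocov hd0 hd
  sq_summable := summable_binomCoeff_sq hd0.le hd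
  moving_average := h.moving_average
  abs_summable := summable_abs_binomCoeff_neg hd0 (by linarith)
  autoregressive := h.autoregressive hd0 (by linarith)
  normalized := binomCoeff_zero _
  decay_a := (decayUniform_binomCoeff (by linarith) (by linarith)).decayUpTo
  decay_b := (decayUniform_binomCoeff (by linarith) (by linarith)).decayUpTo

lemma IsFractionalNoise.isEquivalent_arError (h : IsFractionalNoise μ X ε d v) (hd0 : 0 < d)
    (hd : d < 1 / 2) {φ : (k : ℕ) → Fin k → ℝ}
    (hφ : ∀ k, IsYuleWalker (autocov μ X) k (φ k)) :
    (fun k : ℕ => arError μ X (φ k) - v) ~[atTop] fun k : ℕ => d ^ 2 * v * (k : ℝ)⁻¹ := by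
  have hm := h.isLongMemoryModel hd0 hd
  have heven := hm.stationary.autocov_neg
  have hrec := recursion_of_nat heven (h.autocov_succ hd0.le hd)
  have herr (k : ℕ) : arError μ X (φ k) = levinsonCov d (autocov μ X) k 0 := by
    obtain ⟨ψ, hψ, hψe⟩ := exists_isYuleWalker_error_eq hd0 (by linarith) heven hrec k
    rw [(hm.existsUnique_isYuleWalker k).unique (hφ k) hψ, ← hψe,
      arError_eq_norm_sq hm.stationary.memLp, hψ.norm_sub_sq_eq hm.stationary.inner_toL2]
  have hlim : Tendsto (fun k => arError μ X (φ k)) atTop (𝓝 v) := by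
    have h1 := (hm.isBigO_inv hd0 hd (decayUniform_binomCoeff (by linarith) (by linarith))
      (decayUniform_binomCoeff (by linarith) (by linarith)) hφ).trans_tendsto
      tendsto_inv_atTop_nhds_zero_nat
    simpa using h1.add_const v
  refine isEquivalent_of_succ_eq hd0 hd h.noise.var_pos (fun k => ?_)
    (fun k => hm.le_arError (φ k)) hlim
  rw [herr, herr, levinsonCov_succ_zero hd0 (by linarith) heven hrec]

end FractionalNoise

end LongMemory

theorem mainTheorem2 (d : ℝ) (hd0 : 0 < d) (hd : d < 1 / 2) :
    (∀ (Ω : Type*) [MeasurableSpace Ω] (μ : Measure Ω) [IsProbabilityMeasure μ]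
        (X ε : ℤ → Ω → ℝ) (a b : ℕ → ℝ) (v : ℝ),
        LongMemory.IsLongMemoryModel μ X ε a b d v →
        (∀ k : ℕ, ∃! φ : Fin k → ℝ,
          LongMemory.IsYuleWalker (LongMemory.autocov μ X) k φ) ∧
        ∀ φ : (k : ℕ) → Fin k → ℝ,
          (∀ k, LongMemory.IsYuleWalker (LongMemory.autocov μ X) k (φ k)) →
          (∀ δ : ℝ, 0 < δ →
            (fun k : ℕ => LongMemory.arError μ X (φ k) - v) =O[atTop]
              (fun k : ℕ => (k : ℝ) ^ (-1 + δ))) ∧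
          (LongMemory.DecayUniform a (-d - 1) → LongMemory.DecayUniform b (d - 1) →
            (fun k : ℕ => LongMemory.arError μ X (φ k) - v) =O[atTop]
              (fun k : ℕ => (k : ℝ)⁻¹))) ∧
    (∃ C : ℝ, 0 < C ∧
      ∀ (Ω : Type*) [MeasurableSpace Ω] (μ : Measure Ω) [IsProbabilityMeasure μ]
        (X ε : ℤ → Ω → ℝ) (v : ℝ),
        LongMemory.IsFractionalNoise μ X ε d v →
        LongMemory.IsLongMemoryModel μ X ε
          (LongMemory.binomCoeff (-d)) (LongMemory.binomCoeff d) d v ∧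
        LongMemory.DecayUniform (LongMemory.binomCoeff (-d)) (-d - 1) ∧
        LongMemory.DecayUniform (LongMemory.binomCoeff d) (d - 1) ∧
        ∀ φ : (k : ℕ) → Fin k → ℝ,
          (∀ k, LongMemory.IsYuleWalker (LongMemory.autocov μ X) k (φ k)) →
          (fun k : ℕ => LongMemory.arError μ X (φ k) - v) ~[atTop]
            (fun k : ℕ => C * v * (k : ℝ)⁻¹)) := by
  refine ⟨fun Ω _ μ _ X ε a b v h => ⟨h.existsUnique_isYuleWalker, fun φ hφ =>
    ⟨fun δ hδ => h.isBigO_rpow_add hd0 hd hφ hδ,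
      fun ha hb => h.isBigO_inv hd0 hd ha hb hφ⟩⟩, d ^ 2, by positivity,
    fun Ω _ μ _ X ε v h => ⟨h.isLongMemoryModel hd0 hd,
      LongMemory.decayUniform_binomCoeff (by linarith) (by linarith),
      LongMemory.decayUniform_binomCoeff (by linarith) (by linarith),
      fun φ hφ => h.isEquivalent_arError hd0 hd hφ⟩⟩
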